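/- Let $f\in\mathbb{R}[x,y]$ be a polynomial that is monotone on the positive integers: $f(x,y)\le f(x',y')$ whenever $1\le x\le x'$ and $1\le y\le y'$ are integers. For a finite graph $G$ with degrees $d(\cdot)$ put $$Q(G)=\sum_{uv\in E(G)}\bigl(f(d(u),d(v))+f(d(v),d(u))\bigr).$$ Let $F$ be a finite graph with chromatic number $3$ that has a color-critical edge, i.e. an edge whose deletion decreases the chromatic number. Let $\mathrm{ex}_Q(n,F)$ denote the largest value of $Q(G)$ among the graphs $G$ on $n$ vertices that contain no (not necessarily induced) subgraph isomorphic to $F$. Then there is an $N$ (depending on $f$ and $F$) such that for every $n\ge N$ there is an integer $m$ with $0\le m\le n$ and $$\mathrm{ex}_Q(n,F)=Q(K_{m,n-m}),$$ where $K_{m,n-m}$ is the complete bipartite graph with parts of sizes $m$ and $n-m$ (edgeless if $m\in\{0,n\}$). -/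

import Mathlib

/-- The value `f(x, y)` of a real polynomial `f` in two variables at natural numbers `x`, `y`. -/
noncomputable def polyVal (f : MvPolynomial (Fin 2) ℝ) (x y : ℕ) : ℝ :=
  MvPolynomial.eval ![(x : ℝ), (y : ℝ)] f

/-- `f` is monotone: `x ≤ x'` and `y ≤ y'` imply `f(x, y) ≤ f(x', y')`. The arguments of `f` are
degrees of the two ends of an edge, so they range over the positive integers. -/
def IsMonotonePoly (f : MvPolynomial (Fin 2) ℝ) : Prop :=
  ∀ x x' y y' : ℕ, 1 ≤ x → 1 ≤ y → x ≤ x' → y ≤ y' → polyVal f x y ≤ polyVal f x' y'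

open Classical in
/-- The degree-based topological index `Q` given by `f`: each edge `uv` of `G` contributes both
`f(d(u), d(v))` and `f(d(v), d(u))`. (For symmetric `g`, the index `∑_{uv ∈ E(G)} g(d(u), d(v))` is
the one given by `f = g / 2`.) -/
noncomputable def topIndex (f : MvPolynomial (Fin 2) ℝ) {V : Type*} [Fintype V]
    (G : SimpleGraph V) : ℝ :=
  ∑ e ∈ G.edgeFinset,
    Sym2.lift ⟨fun u v => polyVal f (G.degree u) (G.degree v) + polyVal f (G.degree v) (G.degree u),
      fun _ _ => add_comm _ _⟩ e

/-- An edge of `F` is color-critical if its deletion decreases the chromatic number. -/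
def HasColorCriticalEdge {W : Type*} (F : SimpleGraph W) : Prop :=
  ∃ e ∈ F.edgeSet, (F.deleteEdges {e}).chromaticNumber < F.chromaticNumber

/-- The values of the index on the `F`-free graphs with `n` vertices (`F`-free: no subgraph, induced
or not, is isomorphic to `F`). -/
def indexValues (f : MvPolynomial (Fin 2) ℝ) {W : Type*} (n : ℕ) (F : SimpleGraph W) : Set ℝ :=
  {q | ∃ G : SimpleGraph (Fin n), F.Free G ∧ topIndex f G = q}

/-- `ex_Q(n, F)`: the largest value of the index `Q` among `F`-free graphs with `n` vertices. -/
noncomputable def exIndex (f : MvPolynomial (Fin 2) ℝ) {W : Type*} (n : ℕ)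
    (F : SimpleGraph W) : ℝ :=
  sSup (indexValues f n F)

/-- If `F` has an edge, then the supremum in `exIndex` is a maximum. -/
theorem isGreatest_exIndex (f : MvPolynomial (Fin 2) ℝ) {W : Type*} (n : ℕ)
    (F : SimpleGraph W) (hF : F ≠ ⊥) : IsGreatest (indexValues f n F) (exIndex f n F) := by
  have hfin : (indexValues f n F).Finite :=
    (Set.finite_range (fun G : SimpleGraph (Fin n) => topIndex f G)).subset
      (by rintro q ⟨G, -, rfl⟩; exact ⟨G, rfl⟩)
  have hne : (indexValues f n F).Nonempty := by
    refine ⟨_, ⊥, ?_, rfl⟩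
    rintro ⟨c⟩
    apply hF
    ext a b
    simp only [SimpleGraph.bot_adj, iff_false]
    intro h
    simpa using c.toHom.map_adj h
  exact ⟨hne.csSup_mem hfin, fun q hq => le_csSup hfin.bddAbove hq⟩

/-! Put g(x,y) = f(x,y) + f(y,x), so that 2Q(G) is the sum of g(d(u),d(w)) over ordered adjacent
pairs. Deleting a critical edge of F leaves a bipartite graph with both ends of that edge in one
class. Hence an F-free G contains no K_{t,t} plus an edge inside a part, where t is the order of F.
Either g ≤ 0 and edgeless graphs win, or g has order n^k on linear arguments and unit increments
O(n^(k-1)).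

Let M be the maximum of m(n-m)g(m,n-m), v a vertex of maximum degree Δ, B its neighbourhood and A
the rest. If uw lies in no triangle, then d(w) ≤ n-d(u); so, up to triangles, the edges at u
contribute at most d(u)g(d(u),n-d(u)) ≤ M/(n-d(u)) ≤ M/(n-Δ). Summing over the n-Δ vertices of A and
doubling gives 2M. `EdgeWeight.sum_add_loss_le` records the corrections: a loss of order n^k per
missing A-B pair, a gain of order n^(k-1) per triangle and n^k per edge inside B.

By Kővári–Sós–Turán every neighbourhood spans few edges, so a sum above 2M leaves at most γn²
missing A-B pairs. Then every triangle and every edge inside B meets one of the few vertices with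
linearly many missing pairs (`triangles_and_edges_le`). The gains thus become smaller than the loss,
a contradiction. -/

open Finset

/-! ### The forbidden configuration: a biclique plus an edge -/

/-- `G` has no complete bipartite subgraph with parts of size at least `t` and an edge inside one of
the parts. -/
def SimpleGraph.BicliquePlusEdgeFree {V : Type*} (G : SimpleGraph V) (t : ℕ) : Prop :=
  ∀ S T : Finset V, ∀ p ∈ S, ∀ q ∈ S, G.Adj p q → t ≤ #S → t ≤ #T →
    ¬ ∀ s ∈ S, ∀ r ∈ T, G.Adj s r

/-- An injection into a large finset can be prescribed at two points. -/
theorem Finset.exists_injective_two_points {W V : Type*} [Fintype W] {S : Finset V}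
    (hS : Fintype.card W ≤ #S) {a b : W} (hab : a ≠ b) {p q : V} (hp : p ∈ S) (hq : q ∈ S)
    (hpq : p ≠ q) :
    ∃ e : W → V, Function.Injective e ∧ (∀ w, e w ∈ S) ∧ e a = p ∧ e b = q := by
  classical
  obtain ⟨e0⟩ : Nonempty (W ↪ S) := Function.Embedding.nonempty_of_card_le (by simpa using hS)
  let e1 : W → S := Equiv.swap (e0 a) ⟨p, hp⟩ ∘ e0
  have h1 : Function.Injective e1 := (Equiv.injective _).comp e0.injective
  have h1a : e1 a = ⟨p, hp⟩ := by simp [e1]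
  let e2 : W → S := Equiv.swap (e1 b) ⟨q, hq⟩ ∘ e1
  have h2 : Function.Injective e2 := (Equiv.injective _).comp h1
  have h2a : e2 a = ⟨p, hp⟩ := by
    simp only [e2, Function.comp_apply]
    rw [Equiv.swap_apply_of_ne_of_ne (h1.ne hab), h1a]
    rw [h1a]
    simpa using hpq
  have h2b : e2 b = ⟨q, hq⟩ := by simp [e2]
  exact ⟨fun w => e2 w, Subtype.val_injective.comp h2, fun w => (e2 w).2, by simp [h2a],
    by simp [h2b]⟩

/-- A 2-coloring of F minus the critical edge ab gives a and b the same color, since otherwise it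
would color F. Their color class goes into S with ab sent to pq, the other class into T. -/
theorem SimpleGraph.Free.bicliquePlusEdgeFree {W V : Type*} [Fintype W] {F : SimpleGraph W}
    {G : SimpleGraph V} (hχ : F.chromaticNumber = 3) (hcrit : HasColorCriticalEdge F)
    (hG : F.Free G) : G.BicliquePlusEdgeFree (Fintype.card W) := by
  classical
  intro S T p hp q hq hpq hS hT hST
  apply hG
  obtain ⟨e, he, hlt⟩ := hcrit
  induction e with
  | _ a b =>
  have hab : F.Adj a b := he
  have hcol : (F.deleteEdges {s(a, b)}).Colorable 2 := by
    rw [← SimpleGraph.chromaticNumber_le_iff_colorable]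
    rw [hχ] at hlt
    exact Order.le_of_lt_add_one (lt_of_lt_of_eq hlt (by norm_num))
  obtain ⟨c⟩ := hcol
  have hcab : c a = c b := by
    by_contra hne
    have h2 : F.Colorable 2 := by
      refine ⟨SimpleGraph.Coloring.mk c ?_⟩
      intro x y hxy
      by_cases h : s(x, y) = s(a, b)
      · rcases Sym2.eq_iff.1 h with ⟨rfl, rfl⟩ | ⟨rfl, rfl⟩
        · exact hne
        · exact Ne.symm hne
      · exact c.valid (by simpa [SimpleGraph.deleteEdges_adj, hxy] using h)
    have := h2.chromaticNumber_le
    rw [hχ] at this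
    exact absurd this (by decide)
  obtain ⟨e1, he1, he1S, he1a, he1b⟩ :=
    Finset.exists_injective_two_points hS hab.ne hp hq hpq.ne
  obtain ⟨e2⟩ : Nonempty (W ↪ T) := Function.Embedding.nonempty_of_card_le (by simpa using hT)
  let φ : W → V := fun w => if c w = c a then e1 w else e2 w
  have hadj : ∀ x y, F.Adj x y → G.Adj (φ x) (φ y) := by
    intro x y hxy
    by_cases h : s(x, y) = s(a, b)
    · rcases Sym2.eq_iff.1 h with ⟨rfl, rfl⟩ | ⟨rfl, rfl⟩
      · simpa [φ, hcab, he1a, he1b] using hpq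
      · simpa [φ, hcab, he1a, he1b] using hpq.symm
    · have hne : c x ≠ c y := c.valid (by simpa [SimpleGraph.deleteEdges_adj, hxy] using h)
      by_cases hx : c x = c a
      · have hy : c y ≠ c a := fun h => hne (hx.trans h.symm)
        simp only [φ, hx, hy, if_true, if_false]
        exact hST _ (he1S _) _ (e2 y).2
      · have hy : c y = c a := by omega
        simp only [φ, hx, hy, if_true, if_false]
        exact (hST _ (he1S _) _ (e2 x).2).symm
  have hinj : Function.Injective φ := by
    intro x y hxy
    by_cases hx : c x = c a <;> by_cases hy : c y = c a <;>
      simp only [φ, hx, hy, if_true, if_false] at hxy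
    · exact he1 hxy
    · exact absurd hxy (hST _ (he1S _) _ (e2 y).2).ne
    · exact absurd hxy (hST _ (he1S _) _ (e2 x).2).ne'
    · exact e2.injective (Subtype.val_injective hxy)
  exact ⟨⟨⟨φ, fun {x y} h => hadj x y h⟩, hinj⟩⟩

/-! ### Bicliques in dense relations -/

/-- A qualitative Kővári–Sós–Turán theorem for relations. -/
theorem exists_biclique_of_dense (t : ℕ) {κ : ℝ} (hκ : 0 < κ) :
    ∃ N : ℕ, ∀ (V : Type*) [Fintype V] [DecidableEq V] (r : V → V → Prop) [DecidableRel r],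
      N ≤ Fintype.card V →
      κ * (Fintype.card V : ℝ) ^ 2 < ∑ x : V, (#{y | r x y} : ℝ) →
      ∃ S T : Finset V, #S = t ∧ #T = t ∧ ∀ s ∈ S, ∀ y ∈ T, r y s := by
  -- The first bound lets a row of size κn/2 lose t elements and keep κn/4; the second contradicts
  -- the final count.
  obtain ⟨N, hN⟩ := exists_nat_ge (max (4 * t / κ) (2 * t / (κ * (κ / 4) ^ t)))
  refine ⟨N + 1, fun V _ _ r _ hn hd => ?_⟩
  set n := Fintype.card V with hn_def
  have hn0 : (0 : ℝ) < n := by exact_mod_cast (by omega : 0 < n)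
  have hnN : (N : ℝ) ≤ n := by exact_mod_cast (by omega : N ≤ n)
  have h4 : (t : ℝ) ≤ κ / 4 * n := by
    have : 4 * t / κ ≤ n := (le_max_left _ _).trans (hN.trans hnN)
    rw [div_le_iff₀ hκ] at this
    linarith
  have hcnt : (t : ℝ) ≤ κ / 2 * (κ / 4) ^ t * n := by
    have : 2 * t / (κ * (κ / 4) ^ t) ≤ n := (le_max_right _ _).trans (hN.trans hnN)
    rw [div_le_iff₀ (by positivity)] at this
    linarith
  -- Rows of at least half the assumed average size. Pairs of a row in Y and a t-subset of it are
  -- counted twice below.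
  let Y : Finset V := {x | κ / 2 * n ≤ (#{y | r x y} : ℝ)}
  have hY : κ / 2 * n < #Y := by
    have h1 : ∑ x : V, (#{y | r x y} : ℝ) ≤ ∑ x : V, (κ / 2 * n + if x ∈ Y then (n : ℝ) else 0) := by
      refine sum_le_sum fun x _ => ?_
      have hle : (#{y | r x y} : ℝ) ≤ n := by exact_mod_cast card_le_univ _
      split_ifs with hx
      · have : 0 ≤ κ / 2 * n := by positivity
        linarith
      · simp only [Y, mem_filter, mem_univ, true_and, not_le] at hx
        linarith
    rw [sum_add_distrib, sum_ite_mem] at h1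
    simp only [sum_const, card_univ, nsmul_eq_mul, univ_inter, ← hn_def] at h1
    have h2 : n * (κ / 2 * n) < n * (#Y : ℝ) := by nlinarith
    exact lt_of_mul_lt_mul_left h2 hn0.le
  by_contra! hno
  have hS : ∀ S ∈ powersetCard t (univ : Finset V), (#{x ∈ Y | ∀ s ∈ S, r x s} : ℝ) ≤ t := by
    intro S hS
    by_contra! hlt
    obtain ⟨T, hT, hTc⟩ := exists_subset_card_eq (Nat.cast_lt.1 hlt).le
    obtain ⟨s, hs, y, hy, hsy⟩ := hno S T (mem_powersetCard.1 hS).2 hTc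
    exact hsy ((mem_filter.1 (hT hy)).2 s hs)
  have hdc : ∑ S ∈ powersetCard t (univ : Finset V), #{x ∈ Y | ∀ s ∈ S, r x s}
      = ∑ x ∈ Y, (#{y | r x y}).choose t := by
    refine (sum_card_bipartiteAbove_eq_sum_card_bipartiteBelow
      (fun (S : Finset V) x => ∀ s ∈ S, r x s)).trans ?_
    refine sum_congr rfl fun x _ => ?_
    rw [← card_powersetCard]
    congr 1
    ext S
    simp only [bipartiteBelow, mem_filter, mem_powersetCard, true_and,
      subset_iff, mem_univ]
    tauto
  have hup : ((∑ S ∈ powersetCard t (univ : Finset V), #{x ∈ Y | ∀ s ∈ S, r x s} : ℕ) : ℝ)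
      ≤ (n : ℝ) ^ t / t.factorial * t := by
    push_cast
    refine (sum_le_sum hS).trans ?_
    rw [sum_const, card_powersetCard, card_univ, nsmul_eq_mul, ← hn_def]
    gcongr
    exact Nat.choose_le_pow_div t n
  have hlow : (#Y : ℝ) * ((κ / 4 * n) ^ t / t.factorial)
      ≤ ((∑ x ∈ Y, (#{y | r x y}).choose t : ℕ) : ℝ) := by
    push_cast
    rw [← nsmul_eq_mul]
    refine card_nsmul_le_sum _ _ _ fun x hx => ?_
    have hx' : κ / 2 * n ≤ (#{y | r x y} : ℝ) := (mem_filter.1 hx).2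
    refine le_trans ?_ (Nat.pow_le_choose t _)
    have ht : t ≤ #{y | r x y} + 1 := by
      have : (t : ℝ) ≤ (#{y | r x y} : ℝ) + 1 := by nlinarith
      exact_mod_cast this
    gcongr
    rw [Nat.cast_sub ht]
    push_cast
    linarith
  rw [hdc] at hup
  have hfin := hlow.trans hup
  have hf : (0 : ℝ) < t.factorial := by exact_mod_cast t.factorial_pos
  have hfin' : (#Y : ℝ) * (κ / 4 * n) ^ t ≤ n ^ t * t := by
    rw [← div_le_div_iff_of_pos_right hf]
    convert hfin using 1 <;> ring
  rw [mul_pow] at hfin'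
  have hpos : 0 < (n : ℝ) ^ t := by positivity
  have h5 : (#Y : ℝ) * (κ / 4) ^ t ≤ t := by
    refine le_of_mul_le_mul_left ?_ hpos
    linarith
  have h6 : κ / 2 * n * (κ / 4) ^ t < #Y * (κ / 4) ^ t := by gcongr
  linarith

/-! ### Growth of monotone polynomials -/

/-- The properties of a monotone symmetric polynomial that the extremal argument uses: it has order
of growth `n ^ k` on linear-sized arguments, and increments of order `n ^ (k - 1)`. -/
structure EdgeWeight (g : ℕ → ℕ → ℝ) (k : ℕ) (C : ℝ) : Prop where
  pos : 0 < C
  symm : ∀ x y, g x y = g y x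
  mono : ∀ x x' y y', 1 ≤ x → 1 ≤ y → x ≤ x' → y ≤ y' → g x y ≤ g x' y'
  upper : ∀ n x y, 1 ≤ x → 1 ≤ y → x ≤ n → y ≤ n → g x y ≤ C * (n : ℝ) ^ k
  increment : ∀ n x y s : ℕ, 1 ≤ x → 1 ≤ y → x ≤ n → y + s ≤ n →
    n * (g x (y + s) - g x y) ≤ C * s * (n : ℝ) ^ k
  lower : ∀ l : ℝ, 0 < l → ∃ c : ℝ, 0 < c ∧ ∃ N : ℕ, ∀ n, N ≤ n → ∀ x y : ℕ,
    l * n ≤ x → l * n ≤ y → c * (n : ℝ) ^ k ≤ g x y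
  neg : ∀ ε : ℝ, 0 < ε → ∃ N : ℕ, ∀ n, N ≤ n → ∀ x y, 1 ≤ x → 1 ≤ y →
    -(ε * (n : ℝ) ^ k) ≤ g x y

theorem Polynomial.leadingCoeff_pos_of_bddBelow {p : Polynomial ℝ} {c : ℝ}
    (h : ∀ n : ℕ, 1 ≤ n → c ≤ p.eval (n : ℝ)) (hd : 0 < p.natDegree) : 0 < p.leadingCoeff := by
  by_contra! hlc
  have ht := (p.tendsto_atBot_of_leadingCoeff_nonpos
    (Polynomial.natDegree_pos_iff_degree_pos.1 hd) hlc).comp tendsto_natCast_atTop_atTop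
  obtain ⟨n, hn, hn1⟩ := ((ht.eventually_lt_atBot c).and (Filter.eventually_ge_atTop 1)).exists
  exact absurd (h n hn1) (not_le.2 hn)

theorem Polynomial.exists_eval_le_mul_pow (p : Polynomial ℝ) :
    ∃ C : ℝ, 0 < C ∧ ∀ n : ℕ, 1 ≤ n → p.eval (n : ℝ) ≤ C * (n : ℝ) ^ p.natDegree := by
  refine ⟨∑ i ∈ range (p.natDegree + 1), |p.coeff i| + 1, by positivity, fun n hn => ?_⟩
  have hn1 : (1 : ℝ) ≤ n := by exact_mod_cast hn
  rw [Polynomial.eval_eq_sum_range, add_mul, sum_mul]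
  refine le_trans (sum_le_sum fun i hi => ?_) (le_add_of_nonneg_right (by positivity))
  calc p.coeff i * (n : ℝ) ^ i ≤ |p.coeff i| * (n : ℝ) ^ i := by
        gcongr; exact le_abs_self _
    _ ≤ _ := by
        gcongr ?_ * ?_
        exact pow_le_pow_right₀ hn1 (Nat.lt_succ_iff.1 (mem_range.1 hi))

/-- Otherwise C·X^k - p would be bounded below with leading coefficient that of -p, which is
negative. -/
theorem Polynomial.natDegree_le_of_eval_le {p : Polynomial ℝ} {c C : ℝ} {k : ℕ}
    (hl : ∀ n : ℕ, 1 ≤ n → c ≤ p.eval (n : ℝ))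
    (hu : ∀ n : ℕ, 1 ≤ n → p.eval (n : ℝ) ≤ C * (n : ℝ) ^ k) : p.natDegree ≤ k := by
  by_contra! hk
  have hp := Polynomial.leadingCoeff_pos_of_bddBelow hl (by omega)
  set r : Polynomial ℝ := Polynomial.C C * Polynomial.X ^ k - p with hr
  have hlt : (Polynomial.C C * Polynomial.X ^ k).natDegree < p.natDegree :=
    lt_of_le_of_lt (Polynomial.natDegree_C_mul_X_pow_le _ _) hk
  have hrd : r.natDegree = p.natDegree := Polynomial.natDegree_sub_eq_right_of_natDegree_lt hlt
  have hrl : r.leadingCoeff = -p.leadingCoeff := by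
    rw [Polynomial.leadingCoeff, hrd, hr, Polynomial.coeff_sub,
      Polynomial.coeff_eq_zero_of_natDegree_lt hlt]
    simp
  have := Polynomial.leadingCoeff_pos_of_bddBelow (p := r) (c := 0) (fun n hn => by
    simpa [hr] using hu n hn) (by omega)
  linarith

theorem polyVal_eq_sum (f : MvPolynomial (Fin 2) ℝ) (x y : ℕ) :
    polyVal f x y = ∑ d ∈ f.support, f.coeff d * ((x : ℝ) ^ d 0 * (y : ℝ) ^ d 1) := by
  simp [polyVal, MvPolynomial.eval_eq']

/-- The restriction of `f` to the ray through `(a, b)`. -/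
noncomputable def rayPoly (f : MvPolynomial (Fin 2) ℝ) (a b : ℕ) : Polynomial ℝ :=
  ∑ d ∈ f.support, Polynomial.C (f.coeff d * ((a : ℝ) ^ d 0 * (b : ℝ) ^ d 1)) *
    Polynomial.X ^ d.degree

theorem eval_rayPoly (f : MvPolynomial (Fin 2) ℝ) (a b n : ℕ) :
    (rayPoly f a b).eval (n : ℝ) = polyVal f (a * n) (b * n) := by
  rw [polyVal_eq_sum, rayPoly, Polynomial.eval_finsetSum]
  refine sum_congr rfl fun d _ => ?_
  simp [Finsupp.degree_eq_sum, pow_add, mul_pow]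
  ring

theorem coeff_rayPoly (f : MvPolynomial (Fin 2) ℝ) (a b K : ℕ) :
    (rayPoly f a b).coeff K =
      MvPolynomial.eval ![(a : ℝ), (b : ℝ)] (MvPolynomial.homogeneousComponent K f) := by
  rw [MvPolynomial.homogeneousComponent_apply, rayPoly, Polynomial.finsetSum_coeff, map_sum,
    sum_filter]
  refine sum_congr rfl fun d _ => ?_
  rw [Polynomial.coeff_C_mul, Polynomial.coeff_X_pow]
  by_cases h : d.degree = K
  · subst h
    simp [MvPolynomial.eval_monomial, Finsupp.prod_fintype]
  · simp [h, Ne.symm h]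

/-- The upper bound caps the degree along each positive integer ray at k. So a homogeneous component
of degree above k vanishes at all positive integer points, hence is zero: top-degree terms cannot
merely cancel on the diagonal. -/
theorem MvPolynomial.degree_le_of_polyVal_le {f : MvPolynomial (Fin 2) ℝ} {c C : ℝ} {k : ℕ}
    (hl : ∀ x y, 1 ≤ x → 1 ≤ y → c ≤ polyVal f x y)
    (hu : ∀ n x y, 1 ≤ x → 1 ≤ y → x ≤ n → y ≤ n → polyVal f x y ≤ C * (n : ℝ) ^ k) :
    ∀ d ∈ f.support, d.degree ≤ k := by
  intro d hd
  by_contra! hlt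
  have hzero : MvPolynomial.homogeneousComponent d.degree f = 0 := by
    refine MvPolynomial.funext_set (fun _ => (fun n : ℕ => (n : ℝ)) '' Set.Ici 1)
      (fun _ => (Set.Ici_infinite 1).image (Nat.cast_injective.injOn)) fun x hx => ?_
    obtain ⟨a, ha, hax⟩ := hx 0 (Set.mem_univ _)
    obtain ⟨b, hb, hbx⟩ := hx 1 (Set.mem_univ _)
    have hxx : x = ![(a : ℝ), (b : ℝ)] := by
      ext i; fin_cases i
      · exact hax.symm
      · exact hbx.symm
    simp only [Set.mem_Ici] at ha hb
    rw [hxx, ← coeff_rayPoly, map_zero]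
    refine Polynomial.coeff_eq_zero_of_natDegree_lt (lt_of_le_of_lt ?_ hlt)
    refine Polynomial.natDegree_le_of_eval_le (c := c) (C := C * ((max a b : ℕ) : ℝ) ^ k) ?_ ?_
    · intro n hn
      rw [eval_rayPoly]
      exact hl _ _ (Nat.mul_pos ha hn) (Nat.mul_pos hb hn)
    · intro n hn
      rw [eval_rayPoly, mul_assoc, ← mul_pow, ← Nat.cast_mul]
      exact hu _ _ _ (Nat.mul_pos ha hn) (Nat.mul_pos hb hn)
        (Nat.mul_le_mul_right _ (le_max_left _ _)) (Nat.mul_le_mul_right _ (le_max_right _ _))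
  have := MvPolynomial.coeff_homogeneousComponent d.degree f d
  rw [hzero, if_pos rfl] at this
  exact (MvPolynomial.mem_support_iff.1 hd) (by simpa using this.symm)

/-- A mean value estimate; the factor n on the left avoids the exponent j - 1. -/
theorem mul_pow_add_sub_pow_le {y s n : ℝ} (hy : 0 ≤ y) (hs : 0 ≤ s) (h : y + s ≤ n) (j : ℕ) :
    n * ((y + s) ^ j - y ^ j) ≤ j * s * n ^ j := by
  induction j with
  | zero => simp
  | succ j ih =>
    have hn : 0 ≤ n := by linarith
    have h1 : 0 ≤ (y + s) ^ j - y ^ j := sub_nonneg.2 (pow_le_pow_left₀ hy (by linarith) j)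
    have h2 : y ^ j ≤ n ^ j := pow_le_pow_left₀ hy (by linarith) j
    calc n * ((y + s) ^ (j + 1) - y ^ (j + 1))
        = (y + s) * (n * ((y + s) ^ j - y ^ j)) + s * n * y ^ j := by ring
      _ ≤ n * (j * s * n ^ j) + s * n * n ^ j := by
          have : 0 ≤ n * ((y + s) ^ j - y ^ j) := mul_nonneg hn h1
          gcongr
      _ = _ := by push_cast; ring

theorem exists_increment_bound {f : MvPolynomial (Fin 2) ℝ} {k : ℕ}
    (hk : ∀ d ∈ f.support, d.degree ≤ k) :
    ∃ C : ℝ, ∀ n x y s : ℕ, 1 ≤ x → 1 ≤ y → x ≤ n → y + s ≤ n →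
      n * (polyVal f x (y + s) - polyVal f x y) ≤ C * s * (n : ℝ) ^ k := by
  refine ⟨∑ d ∈ f.support, |f.coeff d| * k, fun n x y s hx hy hxn hyn => ?_⟩
  have hn1 : (1 : ℝ) ≤ n := by exact_mod_cast hx.trans hxn
  rw [polyVal_eq_sum, polyVal_eq_sum, ← sum_sub_distrib, mul_sum, sum_mul, sum_mul]
  refine sum_le_sum fun d hd => ?_
  have hdk : d 0 + d 1 ≤ k := by simpa [Finsupp.degree_eq_sum] using hk d hd
  have h1 := mul_pow_add_sub_pow_le (y := y) (s := s) (n := n) (by positivity) (by positivity)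
    (by exact_mod_cast hyn) (d 1)
  have h0 : (0 : ℝ) ≤ n * (((y : ℝ) + s) ^ d 1 - (y : ℝ) ^ d 1) :=
    mul_nonneg (by positivity)
      (sub_nonneg.2 (pow_le_pow_left₀ (by positivity) (by linarith [Nat.cast_nonneg (α := ℝ) s]) _))
  have hxn' : (x : ℝ) ≤ n := by exact_mod_cast hxn
  push_cast
  calc (n : ℝ) * (f.coeff d * ((x : ℝ) ^ d 0 * ((y : ℝ) + s) ^ d 1)
          - f.coeff d * ((x : ℝ) ^ d 0 * (y : ℝ) ^ d 1))
      = f.coeff d * ((x : ℝ) ^ d 0 * (n * (((y : ℝ) + s) ^ d 1 - (y : ℝ) ^ d 1))) := by ring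
    _ ≤ |f.coeff d| * ((x : ℝ) ^ d 0 * (n * (((y : ℝ) + s) ^ d 1 - (y : ℝ) ^ d 1))) := by
        gcongr; exact le_abs_self _
    _ ≤ |f.coeff d| * ((n : ℝ) ^ d 0 * (d 1 * s * (n : ℝ) ^ d 1)) := by gcongr
    _ = |f.coeff d| * (d 1 * s * (n : ℝ) ^ (d 0 + d 1)) := by rw [pow_add]; ring
    _ ≤ |f.coeff d| * (k * s * (n : ℝ) ^ k) := by
        have h2 : (d 1 : ℝ) ≤ k := by exact_mod_cast (by omega : d 1 ≤ k)
        have h3 : (n : ℝ) ^ (d 0 + d 1) ≤ (n : ℝ) ^ k := pow_le_pow_right₀ hn1 hdk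
        gcongr
    _ = _ := by ring

/-- A monotone symmetric polynomial is nonpositive on the positive integers, or has the growth
properties of `EdgeWeight`. -/
theorem IsMonotonePoly.nonpos_or_edgeWeight {f : MvPolynomial (Fin 2) ℝ} (hf : IsMonotonePoly f)
    (hsymm : ∀ x y, polyVal f x y = polyVal f y x) :
    (∀ x y, 1 ≤ x → 1 ≤ y → polyVal f x y ≤ 0) ∨ ∃ k C, EdgeWeight (polyVal f) k C := by
  set p := rayPoly f 1 1 with hp
  have hpe : ∀ n : ℕ, p.eval (n : ℝ) = polyVal f n n := fun n => by
    rw [hp, eval_rayPoly, one_mul]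
  have hlow : ∀ x y, 1 ≤ x → 1 ≤ y → polyVal f 1 1 ≤ polyVal f x y :=
    fun x y hx hy => hf _ _ _ _ le_rfl le_rfl hx hy
  have hdiag : ∀ n x y, 1 ≤ x → 1 ≤ y → x ≤ n → y ≤ n → polyVal f x y ≤ p.eval (n : ℝ) :=
    fun n x y hx hy hxn hyn => by rw [hpe]; exact hf _ _ _ _ hx hy hxn hyn
  have hpl : ∀ n : ℕ, 1 ≤ n → polyVal f 1 1 ≤ p.eval (n : ℝ) :=
    fun n hn => hdiag n 1 1 le_rfl le_rfl hn hn
  -- Being bounded below, p is constant if its leading coefficient is nonpositive, and the diagonal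
  -- dominates all values. Otherwise its degree serves as k.
  by_cases hlc : p.leadingCoeff ≤ 0
  · left
    have hdeg : p.natDegree = 0 := by
      by_contra h
      exact absurd (Polynomial.leadingCoeff_pos_of_bddBelow hpl (by omega)) (not_lt.2 hlc)
    rw [Polynomial.leadingCoeff, hdeg] at hlc
    intro x y hx hy
    refine (hdiag (max x y) x y hx hy (le_max_left _ _) (le_max_right _ _)).trans ?_
    rw [Polynomial.eq_C_of_natDegree_eq_zero hdeg]
    simpa using hlc
  · right
    push Not at hlc
    obtain ⟨C₁, hC₁, hup⟩ := p.exists_eval_le_mul_pow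
    have hupper : ∀ n x y, 1 ≤ x → 1 ≤ y → x ≤ n → y ≤ n →
        polyVal f x y ≤ C₁ * (n : ℝ) ^ p.natDegree := fun n x y hx hy hxn hyn =>
      (hdiag n x y hx hy hxn hyn).trans (hup n (hx.trans hxn))
    obtain ⟨C₂, hC₂⟩ := exists_increment_bound (MvPolynomial.degree_le_of_polyVal_le hlow hupper)
    refine ⟨p.natDegree, max C₁ C₂, lt_max_of_lt_left hC₁, hsymm, hf, ?_, ?_, ?_, ?_⟩
    · intro n x y hx hy hxn hyn
      refine (hupper n x y hx hy hxn hyn).trans ?_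
      gcongr
      exact le_max_left _ _
    · intro n x y s hx hy hxn hyn
      refine (hC₂ n x y s hx hy hxn hyn).trans ?_
      gcongr
      exact le_max_right _ _
    · intro l hl
      have hev : ∀ᶠ x : ℝ in Filter.atTop,
          p.leadingCoeff / 2 * x ^ p.natDegree ≤ p.eval x := by
        have h1 := p.isEquivalent_atTop_lead.isLittleO.def (c := 1 / 2) (by norm_num)
        filter_upwards [h1, Filter.eventually_ge_atTop 0] with x hx hx0
        simp only [Pi.sub_apply, Real.norm_eq_abs] at hx
        rw [abs_of_nonneg (a := p.leadingCoeff * x ^ p.natDegree) (by positivity)] at hx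
        have := (abs_le.1 hx).1
        linarith
      obtain ⟨T, hT⟩ := Filter.eventually_atTop.1 hev
      obtain ⟨N, hN⟩ := exists_nat_ge (max T 1 / l)
      refine ⟨p.leadingCoeff / 2 * l ^ p.natDegree, by positivity, N, fun n hn x y hx hy => ?_⟩
      have hn' : max T 1 ≤ l * n := by
        rw [div_le_iff₀ hl] at hN
        have : (N : ℝ) ≤ n := by exact_mod_cast hn
        nlinarith
      have hmin : l * n ≤ ((min x y : ℕ) : ℝ) := by
        rw [Nat.cast_min]; exact le_min hx hy
      have hmin1 : 1 ≤ min x y := by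
        exact_mod_cast (le_max_right T 1).trans (hn'.trans hmin)
      calc p.leadingCoeff / 2 * l ^ p.natDegree * (n : ℝ) ^ p.natDegree
          = p.leadingCoeff / 2 * (l * n) ^ p.natDegree := by rw [mul_pow]; ring
        _ ≤ p.leadingCoeff / 2 * ((min x y : ℕ) : ℝ) ^ p.natDegree := by gcongr
        _ ≤ p.eval ((min x y : ℕ) : ℝ) := hT _ ((le_max_left T 1).trans (hn'.trans hmin))
        _ = polyVal f (min x y) (min x y) := hpe _
        _ ≤ polyVal f x y := hf _ _ _ _ hmin1 hmin1 (min_le_left _ _) (min_le_right _ _)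
    · intro ε hε
      obtain ⟨N, hN⟩ := exists_nat_ge (-polyVal f 1 1 / ε)
      refine ⟨N + 1, fun n hn x y hx hy => le_trans ?_ (hlow x y hx hy)⟩
      -- In degree 0 the value f(1,1) is the positive leading coefficient; in positive degree ε·n^k
      -- eventually absorbs it.
      rcases Nat.eq_zero_or_pos p.natDegree with h0 | h0
      · have h1 := hpe 1
        rw [Polynomial.eq_C_of_natDegree_eq_zero h0] at h1
        rw [Polynomial.leadingCoeff, h0] at hlc
        simp only [Polynomial.eval_C] at h1
        have : 0 ≤ ε * (n : ℝ) ^ p.natDegree := by positivity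
        linarith
      · have hn1 : (1 : ℝ) ≤ n := by exact_mod_cast (by omega : 1 ≤ n)
        have h2 : (n : ℝ) ≤ (n : ℝ) ^ p.natDegree := le_self_pow₀ hn1 h0.ne'
        have h3 : (N : ℝ) ≤ n := by exact_mod_cast (by omega : N ≤ n)
        rw [div_le_iff₀ hε] at hN
        nlinarith

/-! ### Edge sums around a vertex of maximum degree -/

section EdgeSums

variable {V : Type*} [Fintype V] [DecidableEq V] (G : SimpleGraph V) [DecidableRel G.Adj]
  {g : ℕ → ℕ → ℝ} {k : ℕ} {C M : ℝ}

theorem SimpleGraph.degree_add_degree_le_card_add (u w : V) :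
    G.degree u + G.degree w ≤ Fintype.card V + #{x | G.Adj u x ∧ G.Adj w x} := by
  rw [← G.card_neighborFinset_eq_degree, ← G.card_neighborFinset_eq_degree,
    ← card_union_add_card_inter]
  refine add_le_add (card_le_univ _) (card_le_card fun x hx => ?_)
  simpa using hx

/-- The contribution of the edges at a vertex is bounded by the value on complete bipartite graphs,
up to a term that counts triangles. -/
theorem EdgeWeight.sum_adj_le (hg : EdgeWeight g k C)
    (hM : ∀ m : ℕ, m ≤ Fintype.card V →
      (m : ℝ) * ((Fintype.card V - m : ℕ) : ℝ) * g m (Fintype.card V - m) ≤ M)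
    {u : V} {Δ : ℕ} (hu : G.degree u ≤ Δ) (hΔ : Δ < Fintype.card V) :
    ∑ w with G.Adj u w, g (G.degree u) (G.degree w) ≤
      M / (Fintype.card V - Δ) - M / (Fintype.card V : ℝ) ^ 2 * (Δ - G.degree u) +
        C * (Fintype.card V : ℝ) ^ k / Fintype.card V *
          ∑ w with G.Adj u w, (#{x | G.Adj u x ∧ G.Adj w x} : ℝ) := by
  set n := Fintype.card V with hn
  set d := G.degree u with hd
  have hM0 : 0 ≤ M := by simpa using hM 0 (Nat.zero_le _)
  have hn0 : (0 : ℝ) < n := by exact_mod_cast (by omega : 0 < n)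
  have hdn : (d : ℝ) < n := by exact_mod_cast (by omega : d < n)
  have hdΔ : (d : ℝ) ≤ Δ := by exact_mod_cast hu
  have hΔn : (Δ : ℝ) < n := by exact_mod_cast hΔ
  have h1 : ∑ w with G.Adj u w, g d (G.degree w) ≤ ∑ w with G.Adj u w,
      (g d (n - d) + C * (n : ℝ) ^ k / n * (#{x | G.Adj u x ∧ G.Adj w x} : ℝ)) := by
    refine sum_le_sum fun w hw => ?_
    have huw : G.Adj u w := (mem_filter.1 hw).2
    have hd1 : 1 ≤ d := (G.degree_pos_iff_exists_adj u).2 ⟨w, huw⟩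
    have hw1 : 1 ≤ G.degree w := (G.degree_pos_iff_exists_adj w).2 ⟨u, huw.symm⟩
    have hle := G.degree_add_degree_le_card_add u w
    have hwn : G.degree w < n := G.degree_lt_card_verts w
    have hC := hg.pos
    -- The excess s of d(w) over n - d is at most the number of triangles on uw, so only triangles
    -- pay for it.
    rcases le_total (G.degree w) (n - d) with h | h
    · exact (hg.mono _ _ _ _ hd1 hw1 le_rfl h).trans (le_add_of_nonneg_right (by positivity))
    · obtain ⟨s, hs⟩ := Nat.exists_eq_add_of_le h
      have hinc := hg.increment n d (n - d) s hd1 (by omega) (by omega) (by omega)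
      rw [hs]
      have hsc : (s : ℝ) ≤ (#{x | G.Adj u x ∧ G.Adj w x} : ℝ) := by
        exact_mod_cast (by omega : s ≤ #{x | G.Adj u x ∧ G.Adj w x})
      have h2 : g d (n - d + s) - g d (n - d) ≤ C * s * (n : ℝ) ^ k / n := by
        rw [le_div_iff₀ hn0]; linarith
      have h3 : C * s * (n : ℝ) ^ k / n ≤
          C * (n : ℝ) ^ k / n * (#{x | G.Adj u x ∧ G.Adj w x} : ℝ) := by
        rw [show C * s * (n : ℝ) ^ k / n = C * (n : ℝ) ^ k / n * s by ring]
        gcongr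
      linarith
  rw [sum_add_distrib, ← mul_sum, sum_const, nsmul_eq_mul] at h1
  have hcard : #{w | G.Adj u w} = d := by
    rw [hd, ← G.card_neighborFinset_eq_degree]
    congr 1; ext; simp
  rw [hcard] at h1
  refine h1.trans (add_le_add_left ?_ _)
  have h4 := hM d (by omega)
  rw [Nat.cast_sub (by omega)] at h4
  have hp : (0 : ℝ) < n - d := by linarith
  have hq : (0 : ℝ) < n - Δ := by linarith
  have h5 : d * g d (n - d) ≤ M / (n - d) := by
    rw [le_div_iff₀ hp]; linarith
  -- The term linear in Δ - d is kept: it later pays for vertices of low degree.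
  have h6 : M / (n - d) ≤ M / (n - Δ) - M / (n : ℝ) ^ 2 * (Δ - d) := by
    have h7 : M / (n - Δ) - M / (n - d) = M * (Δ - d) / ((n - Δ) * (n - d)) := by
      field_simp; ring
    have h8 : M * (Δ - d) / (n : ℝ) ^ 2 ≤ M * (Δ - d) / ((n - Δ) * (n - d)) := by
      have : 0 ≤ M * (Δ - d) := mul_nonneg hM0 (by linarith)
      have : (n - Δ : ℝ) * (n - d) ≤ (n : ℝ) ^ 2 := by
        rw [sq]
        have h9 : (0 : ℝ) ≤ Δ := by positivity
        have h10 : (0 : ℝ) ≤ d := by positivity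
        exact mul_le_mul (by linarith) (by linarith) hp.le hn0.le
      gcongr
    have h11 : M / (n : ℝ) ^ 2 * (Δ - d) = M * (Δ - d) / (n : ℝ) ^ 2 := by ring
    linarith
  exact h5.trans h6

-- Common neighbours cancel. Summed over the non-neighbours u of v, this relates degree deficits to
-- missing pairs.
omit [DecidableEq V] in
theorem SimpleGraph.card_nonadj_sub_card_adj (u v : V) :
    (G.degree v : ℝ) - G.degree u =
      (#{w | G.Adj v w ∧ ¬ G.Adj u w} : ℝ) - #{w | ¬ G.Adj v w ∧ G.Adj u w} := by
  have h1 : G.degree v = #{w | G.Adj v w ∧ ¬ G.Adj u w} + #{w | G.Adj v w ∧ G.Adj u w} := by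
    rw [← G.card_neighborFinset_eq_degree, G.neighborFinset_eq_filter, ← filter_filter,
      ← filter_filter, add_comm, card_filter_add_card_filter_not]
  have h2 : G.degree u = #{w | ¬ G.Adj v w ∧ G.Adj u w} + #{w | G.Adj v w ∧ G.Adj u w} := by
    rw [← G.card_neighborFinset_eq_degree, G.neighborFinset_eq_filter]
    simp_rw [and_comm (b := G.Adj u _)]
    rw [← filter_filter, ← filter_filter, add_comm, card_filter_add_card_filter_not]
  rw [h1, h2]
  push_cast
  ring

/-- The weighted sum over edges, compared with the value `M` on complete bipartite graphs: pairs
missing between the neighbourhood of a vertex of maximum degree and its complement are lost, only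
triangles and edges inside the neighbourhood can be gained. -/
theorem EdgeWeight.sum_add_loss_le (hg : EdgeWeight g k C)
    (hM : ∀ m : ℕ, m ≤ Fintype.card V →
      (m : ℝ) * ((Fintype.card V - m : ℕ) : ℝ) * g m (Fintype.card V - m) ≤ M)
    {v : V} (hv : ∀ u, G.degree u ≤ G.degree v) {c : ℝ} (hc : 0 < c)
    (hlow : ∀ x y : ℕ, (G.degree v : ℝ) / 2 ≤ x → (G.degree v : ℝ) / 2 ≤ y →
      c * (Fintype.card V : ℝ) ^ k ≤ g x y)
    (hneg : ∀ x y : ℕ, 1 ≤ x → 1 ≤ y → -(c * (Fintype.card V : ℝ) ^ k) ≤ g x y)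
    (hMlow : 3 * c * (Fintype.card V : ℝ) ^ k * (Fintype.card V : ℝ) ^ 2 ≤ M) :
    (∑ u, ∑ w with G.Adj u w, g (G.degree u) (G.degree w)) +
      c * (Fintype.card V : ℝ) ^ k *
        ∑ u with ¬ G.Adj v u, (#{w | G.Adj v w ∧ ¬ G.Adj u w} : ℝ) ≤
    2 * M + 2 * (C * (Fintype.card V : ℝ) ^ k / Fintype.card V) *
        ∑ u, ∑ w with G.Adj u w, (#{x | G.Adj u x ∧ G.Adj w x} : ℝ) +
      C * (Fintype.card V : ℝ) ^ k * ∑ u with G.Adj v u, (#{w | G.Adj v w ∧ G.Adj u w} : ℝ) := by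
  set n := Fintype.card V with hn
  set Δ := G.degree v with hΔ
  have hn0 : 0 < n := Fintype.card_pos_iff.2 ⟨v⟩
  have hn0' : (0 : ℝ) < n := by exact_mod_cast hn0
  have hΔn : Δ < n := G.degree_lt_card_verts v
  have hCpos := hg.pos
  have hM0 : 0 ≤ M := by simpa using hM 0 (Nat.zero_le _)
  have hdeg1 : ∀ {u w}, G.Adj u w → 1 ≤ G.degree u := fun {u w} h =>
    (G.degree_pos_iff_exists_adj u).2 ⟨w, h⟩
  let h : V → V → ℝ := fun u w => if G.Adj u w then g (G.degree u) (G.degree w) else 0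
  have hsym : ∀ u w, h u w = h w u := fun u w => by
    simp only [h, G.adj_comm u w, hg.symm (G.degree u)]
  have hrow : ∀ u, ∑ w with G.Adj u w, g (G.degree u) (G.degree w) = ∑ w, h u w := fun u => by
    rw [sum_filter]
  -- With A the non-neighbours of v (v included), the total is 2(AA + AB) - AA + BB; only rows of A
  -- need `sum_adj_le`.
  let AA := ∑ u with ¬ G.Adj v u, ∑ w with ¬ G.Adj v w, h u w
  let AB := ∑ u with ¬ G.Adj v u, ∑ w with G.Adj v w, h u w
  let BB := ∑ u with G.Adj v u, ∑ w with G.Adj v w, h u w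
  have hsplit : ∀ u, ∑ w, h u w = ∑ w with G.Adj v w, h u w + ∑ w with ¬ G.Adj v w, h u w :=
    fun u => (sum_filter_add_sum_filter_not _ _ _).symm
  have hBA : ∑ u with G.Adj v u, ∑ w with ¬ G.Adj v w, h u w = AB := by
    rw [sum_comm]
    exact sum_congr rfl fun u _ => sum_congr rfl fun w _ => hsym _ _
  have hQ : ∑ u, ∑ w with G.Adj u w, g (G.degree u) (G.degree w) = AA + 2 * AB + BB := by
    simp_rw [hrow]
    rw [← sum_filter_add_sum_filter_not _ (fun u => G.Adj v u)]
    simp_rw [hsplit, sum_add_distrib]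
    rw [hBA]
    ring
  have hS : AA + AB ≤ M - M / (n : ℝ) ^ 2 * ∑ u with ¬ G.Adj v u, ((Δ : ℝ) - G.degree u) +
      C * (n : ℝ) ^ k / n *
        ∑ u, ∑ w with G.Adj u w, (#{x | G.Adj u x ∧ G.Adj w x} : ℝ) := by
    have h1 : AA + AB = ∑ u with ¬ G.Adj v u,
        ∑ w with G.Adj u w, g (G.degree u) (G.degree w) := by
      simp_rw [hrow, hsplit, sum_add_distrib]
      exact add_comm _ _
    have hcard : (#{u | ¬ G.Adj v u} : ℝ) = n - Δ := by
      have h2 := card_filter_add_card_filter_not (s := (univ : Finset V)) (fun u => G.Adj v u)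
      have h3 : #{u | G.Adj v u} = Δ := by
        rw [hΔ, ← G.card_neighborFinset_eq_degree, G.neighborFinset_eq_filter]
      rw [h3, card_univ, ← hn] at h2
      rw [← h2]; push_cast; ring
    have hpos : (0 : ℝ) < n - Δ := by
      have : (Δ : ℝ) < n := by exact_mod_cast hΔn
      linarith
    rw [h1]
    refine (sum_le_sum fun u _ => hg.sum_adj_le G hM (hv u) hΔn).trans ?_
    rw [sum_add_distrib, sum_sub_distrib, ← mul_sum, ← mul_sum, sum_const, nsmul_eq_mul, hcard,
      mul_div_cancel₀ _ hpos.ne']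
    exact add_le_add le_rfl (mul_le_mul_of_nonneg_left (sum_le_sum_of_subset_of_nonneg
      (filter_subset _ _) fun u _ _ => sum_nonneg fun w _ => Nat.cast_nonneg _) (by positivity))
  have hBB : BB ≤ C * (n : ℝ) ^ k * ∑ u with G.Adj v u, (#{w | G.Adj v w ∧ G.Adj u w} : ℝ) := by
    rw [mul_sum]
    refine sum_le_sum fun u _ => ?_
    have h1 : ∑ w with G.Adj v w, h u w =
        ∑ w with G.Adj v w ∧ G.Adj u w, g (G.degree u) (G.degree w) := by
      rw [← filter_filter, sum_filter (p := fun w => G.Adj u w)]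
    rw [h1, mul_comm, ← nsmul_eq_mul]
    refine sum_le_card_nsmul _ _ _ fun w hw => ?_
    have huw : G.Adj u w := (mem_filter.1 hw).2.2
    exact hg.upper _ _ _ (hdeg1 huw) (hdeg1 huw.symm) (G.degree_lt_card_verts u).le
      (G.degree_lt_card_verts w).le
  have hD : ∑ u with ¬ G.Adj v u, ((Δ : ℝ) - G.degree u) =
      ∑ u with ¬ G.Adj v u, (#{w | G.Adj v w ∧ ¬ G.Adj u w} : ℝ) -
      ∑ u with ¬ G.Adj v u, (#{w | ¬ G.Adj v w ∧ G.Adj u w} : ℝ) := by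
    rw [← sum_sub_distrib]
    exact sum_congr rfl fun u _ => G.card_nonadj_sub_card_adj u v
  have hD0 : 0 ≤ ∑ u with ¬ G.Adj v u, ((Δ : ℝ) - G.degree u) :=
    sum_nonneg fun u _ => sub_nonneg.2 (by exact_mod_cast hv u)
  set D := ∑ u with ¬ G.Adj v u, ((Δ : ℝ) - G.degree u)
  set eA := ∑ u with ¬ G.Adj v u, (#{w | ¬ G.Adj v w ∧ G.Adj u w} : ℝ) with heA
  -- An edge with an end of degree below Δ/2 may have weight as low as -c·n^k, so it costs 2 against
  -- the count in eA. Such a vertex has degree below its deficit Δ - d(u), so each of the two end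
  -- positions costs at most 2D.
  have hAA : c * (n : ℝ) ^ k * (eA - 4 * D) ≤ AA := by
    let l : V → ℝ := fun u => if (G.degree u : ℝ) < Δ / 2 then 1 else 0
    let a : V → V → ℝ := fun u w => if G.Adj u w then 1 else 0
    have hpt : ∀ u w, c * (n : ℝ) ^ k * (a u w - 2 * (l u * a u w) - 2 * (l w * a w u)) ≤ h u w := by
      intro u w
      have hcn : 0 < c * (n : ℝ) ^ k := by positivity
      by_cases huw : G.Adj u w
      · have hn1 := hneg _ _ (hdeg1 huw) (hdeg1 huw.symm)
        simp only [h, a, l, huw, huw.symm, if_true]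
        split_ifs with h1 h2 h2
        · linarith
        · linarith
        · linarith
        · have := hlow _ _ (not_lt.1 h1) (not_lt.1 h2)
          linarith
      · have hwu : ¬ G.Adj w u := fun h => huw h.symm
        simp [h, a, huw, hwu]
    have hla : ∑ u with ¬ G.Adj v u, ∑ w with ¬ G.Adj v w, l u * a u w ≤ D := by
      refine sum_le_sum fun u _ => ?_
      rw [← mul_sum]
      have h1 : ∑ w with ¬ G.Adj v w, a u w ≤ G.degree u := by
        simp only [a]
        rw [sum_boole, ← G.card_neighborFinset_eq_degree]
        refine Nat.cast_le.2 (card_le_card fun w hw => ?_)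
        simpa using (mem_filter.1 hw).2
      have h2 : (0 : ℝ) ≤ Δ - G.degree u := sub_nonneg.2 (by exact_mod_cast hv u)
      simp only [l]
      split_ifs with h3
      · linarith
      · simpa using h2
    have hla' : ∑ u with ¬ G.Adj v u, ∑ w with ¬ G.Adj v w, l w * a w u ≤ D := by
      rw [sum_comm]; exact hla
    have ha : ∑ u with ¬ G.Adj v u, ∑ w with ¬ G.Adj v w, a u w = eA := by
      refine sum_congr rfl fun u _ => ?_
      simp only [a]
      rw [sum_boole, filter_filter]
    calc c * (n : ℝ) ^ k * (eA - 4 * D)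
        ≤ c * (n : ℝ) ^ k * (eA - 2 * ∑ u with ¬ G.Adj v u, ∑ w with ¬ G.Adj v w, l u * a u w -
          2 * ∑ u with ¬ G.Adj v u, ∑ w with ¬ G.Adj v w, l w * a w u) := by
          refine mul_le_mul_of_nonneg_left (by linarith) (by positivity)
      _ = ∑ u with ¬ G.Adj v u, ∑ w with ¬ G.Adj v w,
          c * (n : ℝ) ^ k * (a u w - 2 * (l u * a u w) - 2 * (l w * a w u)) := by
          simp_rw [← mul_sum, sum_sub_distrib, ← mul_sum]
          rw [ha]
      _ ≤ AA := sum_le_sum fun u _ => sum_le_sum fun w _ => hpt u w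
  -- Doubling the row bound gains 6D in units of c·n^k; AA returns at most 4D, and D + eA is the
  -- number of missing pairs.
  have hMD : 3 * c * (n : ℝ) ^ k * D ≤ M / (n : ℝ) ^ 2 * D := by
    gcongr
    rw [le_div_iff₀ (by positivity)]
    exact hMlow
  have hcD : 0 ≤ c * (n : ℝ) ^ k * D := by positivity
  rw [hQ]
  rw [show ∑ u with ¬ G.Adj v u, (#{w | G.Adj v w ∧ ¬ G.Adj u w} : ℝ) = D + eA by rw [hD]; ring]
  linarith

end EdgeSums

/-! ### Structure of nearly complete bipartite graphs -/

theorem Finset.card_filter_lt_mul_le_sum {α : Type*} (s : Finset α) (h : α → ℝ)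
    (h0 : ∀ x ∈ s, 0 ≤ h x) (a : ℝ) : (#{x ∈ s | a < h x} : ℝ) * a ≤ ∑ x ∈ s, h x := by
  rw [← nsmul_eq_mul]
  exact (card_nsmul_le_sum _ _ _ fun x hx => (mem_filter.1 hx).2.le).trans
    (sum_le_sum_of_subset_of_nonneg (filter_subset _ _) fun x hx _ => h0 x hx)

section Structure

variable {V : Type*} [Fintype V] [DecidableEq V] {G : SimpleGraph V} [DecidableRel G.Adj] {t : ℕ}

-- Otherwise p, q and t vertices of S, at most t + 2 in all, would have t common neighbours in Y,
-- and pq would complete the forbidden configuration.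
omit [Fintype V] in
theorem SimpleGraph.BicliquePlusEdgeFree.card_lt (hG : G.BicliquePlusEdgeFree t) {p q : V}
    (hpq : G.Adj p q) {S Y : Finset V} (hS : t ≤ #S) {θ : ℝ}
    (hp : (#{y ∈ Y | ¬ G.Adj p y} : ℝ) ≤ θ) (hq : (#{y ∈ Y | ¬ G.Adj q y} : ℝ) ≤ θ)
    (h : ∀ s ∈ S, (#{y ∈ Y | ¬ G.Adj s y} : ℝ) ≤ θ) : (#Y : ℝ) < (t + 2) * θ + t := by
  obtain ⟨S', hS', hcard⟩ := exists_subset_card_eq hS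
  have hθ : 0 ≤ θ := le_trans (Nat.cast_nonneg _) hp
  set R := insert p (insert q S') with hR
  have hRcard : #R ≤ t + 2 := by
    have h1 : #R ≤ _ := card_insert_le p (insert q S')
    have h2 := card_insert_le q S'
    omega
  have hRt : t ≤ #R := hcard ▸ card_le_card ((subset_insert _ _).trans (subset_insert _ _))
  have hmiss : ∀ s ∈ R, (#{y ∈ Y | ¬ G.Adj s y} : ℝ) ≤ θ := by
    intro s hs
    rcases mem_insert.1 hs with rfl | hs
    · exact hp
    rcases mem_insert.1 hs with rfl | hs
    · exact hq
    exact h s (hS' hs)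
  set T := {y ∈ Y | ∀ s ∈ R, G.Adj s y} with hT
  have hTt : #T < t := by
    by_contra! hle
    exact hG R T p (by simp [hR]) q (by simp [hR]) hpq hRt hle
      fun s hs r hr => (mem_filter.1 hr).2 s hs
  have hsub : Y ⊆ T ∪ R.biUnion fun s => {y ∈ Y | ¬ G.Adj s y} := by
    intro y hy
    by_cases hall : ∀ s ∈ R, G.Adj s y
    · exact mem_union_left _ (mem_filter.2 ⟨hy, hall⟩)
    · push Not at hall
      obtain ⟨s, hs, hsy⟩ := hall
      exact mem_union_right _ (mem_biUnion.2 ⟨s, hs, mem_filter.2 ⟨hy, hsy⟩⟩)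
  have h1 : (#Y : ℝ) ≤ #T + ∑ s ∈ R, (#{y ∈ Y | ¬ G.Adj s y} : ℝ) := by
    exact_mod_cast (card_le_card hsub).trans ((card_union_le _ _).trans
      (add_le_add_right card_biUnion_le _))
  have h2 : ∑ s ∈ R, (#{y ∈ Y | ¬ G.Adj s y} : ℝ) ≤ #R * θ := by
    rw [← nsmul_eq_mul]; exact sum_le_card_nsmul _ _ _ hmiss
  have h3 : (#R : ℝ) * θ ≤ (t + 2) * θ := by
    gcongr; exact_mod_cast hRcard
  have h4 : (#T : ℝ) < t := by exact_mod_cast hTt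
  linarith

omit [DecidableEq V] in
/-- The neighbourhoods in a graph without a large biclique plus an edge are sparse. -/
theorem SimpleGraph.BicliquePlusEdgeFree.exists_link_le (ht : 1 ≤ t) {κ : ℝ} (hκ : 0 < κ) :
    ∃ N : ℕ, ∀ (V : Type*) [Fintype V] (G : SimpleGraph V) [DecidableRel G.Adj],
      N ≤ Fintype.card V → G.BicliquePlusEdgeFree t → ∀ z,
      ∑ x with G.Adj z x, (#{y | G.Adj z y ∧ G.Adj x y} : ℝ) ≤ κ * (Fintype.card V : ℝ) ^ 2 := by
  obtain ⟨N, hN⟩ := exists_biclique_of_dense t hκ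
  refine ⟨N, fun V _ G _ hn hG z => ?_⟩
  classical
  by_contra! hlt
  obtain ⟨S, T, hS, hT, hST⟩ := hN V (fun x y => G.Adj z x ∧ G.Adj z y ∧ G.Adj x y) hn
    (hlt.trans_le (by
      rw [sum_filter]
      refine sum_le_sum fun x _ => ?_
      split_ifs with h
      · simp [h]
      · exact Nat.cast_nonneg _))
  obtain ⟨w, hw⟩ := card_pos.1 (by omega : 0 < #S)
  obtain ⟨y, hy⟩ := card_pos.1 (by omega : 0 < #T)
  -- Since z is adjacent to all of S and T, adding z to S creates the extra edge.
  refine hG (insert z S) T z (mem_insert_self _ _) w (mem_insert_of_mem hw) (hST w hw y hy).2.1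
    (hS ▸ card_le_card (subset_insert _ _)) hT.ge fun s hs r hr => ?_
  rcases mem_insert.1 hs with rfl | hs
  · exact (hST w hw r hr).1
  · exact (hST s hs r hr).2.2.symm

-- By Markov's inequality at most cn/2 vertices of X miss more than θn of Y.
omit [Fintype V] [DecidableEq V] in
theorem SimpleGraph.le_card_filter_nonadj_le {X Y : Finset V} {n γ c θ : ℝ} (hn : 0 < n)
    (hX : c * n ≤ #X) (hec : ∑ u ∈ X, (#{y ∈ Y | ¬ G.Adj u y} : ℝ) ≤ γ * n ^ 2)
    (hγ : γ ≤ c * θ / 2) (hθ : 0 < θ) (ht : 2 * t ≤ c * n) :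
    t ≤ #{u ∈ X | (#{y ∈ Y | ¬ G.Adj u y} : ℝ) ≤ θ * n} := by
  have h1 := card_filter_lt_mul_le_sum X (fun u => (#{y ∈ Y | ¬ G.Adj u y} : ℝ))
    (fun _ _ => Nat.cast_nonneg _) (θ * n)
  have h2 := card_filter_add_card_filter_not (s := X)
    (fun u => (#{y ∈ Y | ¬ G.Adj u y} : ℝ) ≤ θ * n)
  simp_rw [not_le] at h2
  set bad := #{u ∈ X | θ * n < (#{y ∈ Y | ¬ G.Adj u y} : ℝ)}
  have h3 : (bad : ℝ) * (θ * n) ≤ c * n / 2 * (θ * n) := by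
    have : γ * n ^ 2 ≤ c * θ / 2 * n ^ 2 := by gcongr
    nlinarith
  have h4 : (bad : ℝ) ≤ c * n / 2 := le_of_mul_le_mul_right h3 (by positivity)
  have h5 : (#{u ∈ X | (#{y ∈ Y | ¬ G.Adj u y} : ℝ) ≤ θ * n} : ℝ) + bad = #X := by
    exact_mod_cast h2
  have h6 : (t : ℝ) ≤ (#{u ∈ X | (#{y ∈ Y | ¬ G.Adj u y} : ℝ) ≤ θ * n} : ℝ) := by linarith
  exact_mod_cast h6

/-- If every triangle meets `X`, the ordered triangles are counted by the links of `X`. -/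
theorem SimpleGraph.sum_triangles_le (X : Finset V)
    (hX : ∀ u w x, G.Adj u w → G.Adj u x → G.Adj w x → u ∈ X ∨ w ∈ X ∨ x ∈ X) :
    ∑ u, ∑ w with G.Adj u w, (#{x | G.Adj u x ∧ G.Adj w x} : ℝ) ≤
      3 * ∑ u ∈ X, ∑ w with G.Adj u w, (#{x | G.Adj u x ∧ G.Adj w x} : ℝ) := by
  let τ : V → V → V → ℝ := fun u w x => if G.Adj u w ∧ G.Adj u x ∧ G.Adj w x then 1 else 0
  have hτ : ∀ u, ∑ w with G.Adj u w, (#{x | G.Adj u x ∧ G.Adj w x} : ℝ) =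
      ∑ w, ∑ x, τ u w x := by
    intro u
    rw [sum_filter]
    refine sum_congr rfl fun w _ => ?_
    by_cases h : G.Adj u w <;> simp [τ, h, sum_boole]
  have h12 : ∀ u w x, τ u w x = τ w u x := fun u w x => by
    simp only [τ, G.adj_comm u w, and_comm (a := G.Adj u x)]
  have h13 : ∀ u w x, τ u w x = τ x w u := fun u w x => by
    simp only [τ, G.adj_comm u w, G.adj_comm u x, G.adj_comm w x]
    congr 1
    simp only [eq_iff_iff]; tauto
  let i : V → ℝ := fun u => if u ∈ X then 1 else 0
  simp_rw [hτ]
  set R := ∑ u ∈ X, ∑ w, ∑ x, τ u w x with hR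
  have e1 : ∑ u, ∑ w, ∑ x, i u * τ u w x = R := by
    simp_rw [← mul_sum, i, ite_mul, one_mul, zero_mul]
    rw [sum_ite_mem, univ_inter]
  have e2 : ∑ u, ∑ w, ∑ x, i w * τ u w x = R := by
    rw [← e1, sum_comm]
    simp_rw [h12]
  have e3 : ∑ u, ∑ w, ∑ x, i x * τ u w x = R := by
    calc ∑ u, ∑ w, ∑ x, i x * τ u w x = ∑ w, ∑ u, ∑ x, i x * τ x w u := by
          rw [sum_comm]
          simp_rw [fun u w x => h13 u w x]
      _ = ∑ w, ∑ x, ∑ u, i x * τ x w u := sum_congr rfl fun w _ => sum_comm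
      _ = ∑ x, ∑ w, ∑ u, i x * τ x w u := sum_comm
      _ = R := e1
  calc ∑ u, ∑ w, ∑ x, τ u w x
      ≤ ∑ u, ∑ w, ∑ x, (i u * τ u w x + i w * τ u w x + i x * τ u w x) := by
        refine sum_le_sum fun u _ => sum_le_sum fun w _ => sum_le_sum fun x _ => ?_
        by_cases h : G.Adj u w ∧ G.Adj u x ∧ G.Adj w x
        · have := hX u w x h.1 h.2.1 h.2.2
          simp only [τ, h, i]
          split_ifs <;> simp_all
        · simp [τ, h]
    _ = 3 * R := by
        simp_rw [sum_add_distrib]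
        rw [e1, e2, e3]; ring

omit [Fintype V] in
theorem SimpleGraph.sum_card_adj_le (B X : Finset V)
    (hX : ∀ u ∈ B, ∀ w ∈ B, G.Adj u w → u ∈ X ∨ w ∈ X) (hXB : X ⊆ B) :
    ∑ u ∈ B, (#{w ∈ B | G.Adj u w} : ℝ) ≤ 2 * ∑ u ∈ X, (#{w ∈ B | G.Adj u w} : ℝ) := by
  let τ : V → V → ℝ := fun u w => if G.Adj u w then 1 else 0
  have hτ : ∀ u, (#{w ∈ B | G.Adj u w} : ℝ) = ∑ w ∈ B, τ u w := fun u => (sum_boole _ _).symm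
  have h12 : ∀ u w, τ u w = τ w u := fun u w => by simp only [τ, G.adj_comm u w]
  let i : V → ℝ := fun u => if u ∈ X then 1 else 0
  simp_rw [hτ]
  set R := ∑ u ∈ X, ∑ w ∈ B, τ u w with hR
  have e1 : ∑ u ∈ B, ∑ w ∈ B, i u * τ u w = R := by
    simp_rw [← mul_sum, i, ite_mul, one_mul, zero_mul]
    rw [sum_ite_mem, inter_eq_right.2 hXB]
  have e2 : ∑ u ∈ B, ∑ w ∈ B, i w * τ u w = R := by
    rw [← e1, sum_comm]
    simp_rw [h12]
  calc ∑ u ∈ B, ∑ w ∈ B, τ u w ≤ ∑ u ∈ B, ∑ w ∈ B, (i u * τ u w + i w * τ u w) := by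
        refine sum_le_sum fun u hu => sum_le_sum fun w hw => ?_
        by_cases h : G.Adj u w
        · have := hX u hu w hw h
          simp only [τ, h, i]
          split_ifs <;> simp_all
        · simp [τ, h]
    _ = 2 * R := by
        simp_rw [sum_add_distrib]
        rw [e1, e2]; ring

/-- In a graph that is nearly complete bipartite with parts `A`, `B`, where `B` consists of
neighbours of one vertex, triangles and edges inside `B` are few in terms of the missing pairs. -/
theorem SimpleGraph.BicliquePlusEdgeFree.triangles_and_edges_le (hG : G.BicliquePlusEdgeFree t)
    {v : V} {A B : Finset V} (hAB : ∀ u, u ∈ A ∨ u ∈ B) (hB : ∀ w ∈ B, G.Adj v w)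
    {n θ₁ θ₂ κ γ c : ℝ} (hn : 0 < n) (hθ₁ : 0 < θ₁) (hθ₂ : 0 < θ₂) (hθ : θ₂ ≤ θ₁) (hκ : 0 < κ)
    (hγ : γ ≤ c * θ₂ / 2) (hc : 0 < c)
    (hA' : c * n ≤ #A) (hB' : c * n ≤ #B)
    (hec : ∑ u ∈ A, (#{w ∈ B | ¬ G.Adj u w} : ℝ) ≤ γ * n ^ 2)
    (ht₁ : (t + 2) * (θ₁ * n) + t ≤ c * n) (ht₂ : 2 * t ≤ c * n) (ht₃ : t ≤ θ₂ * n)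
    (hlink : ∀ z, ∑ x with G.Adj z x, (#{y | G.Adj z y ∧ G.Adj x y} : ℝ) ≤ κ * n ^ 2) :
    θ₁ * ∑ u, ∑ w with G.Adj u w, (#{x | G.Adj u x ∧ G.Adj w x} : ℝ) ≤
      6 * κ * n * ∑ u ∈ A, (#{w ∈ B | ¬ G.Adj u w} : ℝ) ∧
    θ₁ * ∑ u ∈ B, (#{w ∈ B | G.Adj u w} : ℝ) ≤
      2 * (t + 3) * θ₂ * ∑ u ∈ A, (#{w ∈ B | ¬ G.Adj u w} : ℝ) := by
  have hswap : ∑ w ∈ B, (#{u ∈ A | ¬ G.Adj w u} : ℝ) =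
      ∑ u ∈ A, (#{w ∈ B | ¬ G.Adj u w} : ℝ) := by
    have := sum_card_bipartiteAbove_eq_sum_card_bipartiteBelow (s := B) (t := A)
      (fun w u => ¬ G.Adj w u)
    simp only [bipartiteAbove, bipartiteBelow] at this
    simp_rw [G.adj_comm _ _] at this ⊢
    exact_mod_cast this
  set ec := ∑ u ∈ A, (#{w ∈ B | ¬ G.Adj u w} : ℝ) with hec_def
  -- The exceptional vertices: at most ec/(θ₁n) on each side, yet they meet every edge inside a
  -- part.
  set XA := {u ∈ A | θ₁ * n < (#{w ∈ B | ¬ G.Adj u w} : ℝ)} with hXA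
  set XB := {w ∈ B | θ₁ * n < (#{u ∈ A | ¬ G.Adj w u} : ℝ)} with hXB
  have hXAc : (#XA : ℝ) * (θ₁ * n) ≤ ec :=
    card_filter_lt_mul_le_sum A _ (fun _ _ => Nat.cast_nonneg _) _
  have hXBc : (#XB : ℝ) * (θ₁ * n) ≤ ec := by
    rw [← hswap]
    exact card_filter_lt_mul_le_sum B _ (fun _ _ => Nat.cast_nonneg _) _
  have hγ₁ : γ ≤ c * θ₁ / 2 := hγ.trans (by gcongr)
  have hA1 : ∀ p ∈ A, ∀ q ∈ A, G.Adj p q → p ∈ XA ∨ q ∈ XA := by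
    intro p hp q hq hpq
    by_contra! h
    have hp' : (#{w ∈ B | ¬ G.Adj p w} : ℝ) ≤ θ₁ * n := by
      simpa [hXA, hp] using h.1
    have hq' : (#{w ∈ B | ¬ G.Adj q w} : ℝ) ≤ θ₁ * n := by
      simpa [hXA, hq] using h.2
    have := hG.card_lt hpq (le_card_filter_nonadj_le hn hA' hec hγ₁ hθ₁ ht₂) hp' hq'
      fun s hs => (mem_filter.1 hs).2
    linarith
  have hB1 : ∀ p ∈ B, ∀ q ∈ B, G.Adj p q → p ∈ XB ∨ q ∈ XB := by
    intro p hp q hq hpq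
    by_contra! h
    have hp' : (#{u ∈ A | ¬ G.Adj p u} : ℝ) ≤ θ₁ * n := by
      simpa [hXB, hp] using h.1
    have hq' : (#{u ∈ A | ¬ G.Adj q u} : ℝ) ≤ θ₁ * n := by
      simpa [hXB, hq] using h.2
    have := hG.card_lt hpq
      (le_card_filter_nonadj_le hn hB' (hswap.trans_le hec) hγ₁ hθ₁ ht₂) hp' hq'
      fun s hs => (mem_filter.1 hs).2
    linarith
  -- Neighbours of z in B are common neighbours of the adjacent vertices v and z, so `card_lt`
  -- applies with typical vertices of A; t ≤ θ₂n turns t + 2 into t + 3.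
  have hdeg : ∀ z ∈ B, (#{w ∈ B | G.Adj z w} : ℝ) ≤ (t + 3) * θ₂ * n := by
    intro z hz
    have hzero : ∀ p, (∀ w ∈ B, G.Adj z w → G.Adj p w) →
        (#{y ∈ {w ∈ B | G.Adj z w} | ¬ G.Adj p y} : ℝ) ≤ θ₂ * n := by
      intro p hp
      rw [filter_filter, filter_false_of_mem]
      · simpa using by positivity
      · intro y hy h
        exact h.2 (hp y hy h.1)
    have := hG.card_lt (hB z hz) (Y := {w ∈ B | G.Adj z w})
      (le_card_filter_nonadj_le hn hA' hec hγ hθ₂ ht₂)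
      (hzero v fun w hw _ => hB w hw) (hzero z fun w _ h => h)
      fun s hs => le_trans (Nat.cast_le.2 (card_le_card (filter_subset_filter _
        (filter_subset _ _)))) (mem_filter.1 hs).2
    linarith
  constructor
  -- By pigeonhole a triangle has an edge inside A or inside B.
  · have h1 := sum_triangles_le (G := G) (XA ∪ XB) (fun u w x huw hux hwx => by
      simp only [mem_union]
      rcases hAB u with hu | hu <;> rcases hAB w with hw | hw <;> rcases hAB x with hx | hx
      · have := hA1 u hu w hw huw; tauto
      · have := hA1 u hu w hw huw; tauto
      · have := hA1 u hu x hx hux; tauto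
      · have := hB1 w hw x hx hwx; tauto
      · have := hA1 w hw x hx hwx; tauto
      · have := hB1 u hu x hx hux; tauto
      · have := hB1 u hu w hw huw; tauto
      · have := hB1 u hu w hw huw; tauto)
    have h2 : ∑ u ∈ XA ∪ XB, ∑ w with G.Adj u w, (#{x | G.Adj u x ∧ G.Adj w x} : ℝ) ≤
        (#XA + #XB) * (κ * n ^ 2) := by
      refine (sum_le_card_nsmul _ _ _ fun u _ => hlink u).trans ?_
      rw [nsmul_eq_mul]
      gcongr
      exact_mod_cast card_union_le _ _
    calc _ ≤ θ₁ * (3 * ((#XA + #XB) * (κ * n ^ 2))) := by gcongr; linarith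
      _ = 3 * κ * n * (#XA * (θ₁ * n) + #XB * (θ₁ * n)) := by ring
      _ ≤ 3 * κ * n * (ec + ec) := by gcongr
      _ = _ := by ring
  · have h1 := sum_card_adj_le (G := G) B XB hB1 (filter_subset _ _)
    have h2 : ∑ u ∈ XB, (#{w ∈ B | G.Adj u w} : ℝ) ≤ #XB * ((t + 3) * θ₂ * n) := by
      rw [← nsmul_eq_mul]
      exact sum_le_card_nsmul _ _ _ fun u hu => hdeg u (mem_filter.1 hu).1
    calc _ ≤ θ₁ * (2 * (#XB * ((t + 3) * θ₂ * n))) := by gcongr; linarith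
      _ = 2 * (t + 3) * θ₂ * (#XB * (θ₁ * n)) := by ring
      _ ≤ 2 * (t + 3) * θ₂ * ec := by gcongr

end Structure

/-! ### The extremal estimate -/

theorem EdgeWeight.sum_le_card_mul {V : Type*} [Fintype V] [DecidableEq V] {G : SimpleGraph V}
    [DecidableRel G.Adj] {g : ℕ → ℕ → ℝ} {k : ℕ} {C : ℝ} (hg : EdgeWeight g k C) :
    ∑ u, ∑ w with G.Adj u w, g (G.degree u) (G.degree w) ≤
      C * (Fintype.card V : ℝ) ^ k * ∑ u, (#{w | G.Adj u w} : ℝ) := by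
  rw [mul_sum]
  refine sum_le_sum fun u _ => ?_
  rw [mul_comm, ← nsmul_eq_mul]
  refine sum_le_card_nsmul _ _ _ fun w hw => ?_
  have huw : G.Adj u w := (mem_filter.1 hw).2
  exact hg.upper _ _ _ ((G.degree_pos_iff_exists_adj u).2 ⟨w, huw⟩)
    ((G.degree_pos_iff_exists_adj w).2 ⟨u, huw.symm⟩) (G.degree_lt_card_verts u).le
    (G.degree_lt_card_verts w).le

/-- Used to force A to have linear size: B spans few edges, so most edges must meet A. -/
theorem SimpleGraph.sum_card_adj_le_of_split {V : Type*} [Fintype V] [DecidableEq V]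
    {G : SimpleGraph V} [DecidableRel G.Adj] (A B : Finset V) (hAB : A = Bᶜ) :
    ∑ u, (#{w | G.Adj u w} : ℝ) ≤
      2 * (#A * Fintype.card V) + ∑ u ∈ B, (#{w ∈ B | G.Adj u w} : ℝ) := by
  have hle : ∀ s : Finset V, (#s : ℝ) ≤ Fintype.card V := fun s =>
    Nat.cast_le.2 (card_le_univ s)
  have hA : ∑ u ∈ A, (#{w | G.Adj u w} : ℝ) ≤ #A * Fintype.card V := by
    rw [← nsmul_eq_mul]
    exact sum_le_card_nsmul _ _ _ fun u _ => hle _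
  have hB : ∑ u ∈ B, (#{w | G.Adj u w} : ℝ) ≤
      #A * Fintype.card V + ∑ u ∈ B, (#{w ∈ B | G.Adj u w} : ℝ) := by
    have h1 : ∀ u, (#{w | G.Adj u w} : ℝ) ≤ #A + (#{w ∈ B | G.Adj u w} : ℝ) := by
      intro u
      have hsub : ({w | G.Adj u w} : Finset V) ⊆ A ∪ {w ∈ B | G.Adj u w} := by
        intro w hw
        by_cases hwB : w ∈ B
        · exact mem_union_right _ (mem_filter.2 ⟨hwB, (mem_filter.1 hw).2⟩)
        · exact mem_union_left _ (by rw [hAB]; exact mem_compl.2 hwB)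
      exact_mod_cast (card_le_card hsub).trans (card_union_le _ _)
    refine (sum_le_sum fun u _ => h1 u).trans ?_
    rw [sum_add_distrib, sum_const, nsmul_eq_mul, mul_comm]
    exact add_le_add (mul_le_mul_of_nonneg_left (hle B) (Nat.cast_nonneg _)) le_rfl
  have := sum_add_sum_compl B (fun u => (#{w | G.Adj u w} : ℝ))
  rw [← hAB] at this
  linarith

/-- The value on nearly balanced complete bipartite graphs has the maximum order of growth. -/
theorem EdgeWeight.exists_le_bipartite {g : ℕ → ℕ → ℝ} {k : ℕ} {C : ℝ} (hg : EdgeWeight g k C) :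
    ∃ c : ℝ, 0 < c ∧ ∃ N : ℕ, ∀ n, N ≤ n → ∀ M : ℝ,
      (∀ m : ℕ, m ≤ n → (m : ℝ) * ((n - m : ℕ) : ℝ) * g m (n - m) ≤ M) →
      c * (n : ℝ) ^ k * (n : ℝ) ^ 2 ≤ M := by
  obtain ⟨c, hc, N, hN⟩ := hg.lower (1 / 4) (by norm_num)
  refine ⟨c / 16, by positivity, max N 2, fun n hn M hM => ?_⟩
  have h1 : (n : ℝ) ≤ 4 * ((n / 2 : ℕ) : ℝ) := by
    have : 2 ≤ n := (le_max_right _ _).trans hn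
    exact_mod_cast (by omega : n ≤ 4 * (n / 2))
  have h2 : (n : ℝ) ≤ 4 * ((n - n / 2 : ℕ) : ℝ) := by exact_mod_cast (by omega : n ≤ 4 * (n - n / 2))
  have h3 := hN n ((le_max_left _ _).trans hn) (n / 2) (n - n / 2) (by linarith) (by linarith)
  calc c / 16 * (n : ℝ) ^ k * (n : ℝ) ^ 2
      = (1 / 4 * n) * (1 / 4 * n) * (c * (n : ℝ) ^ k) := by ring
    _ ≤ ((n / 2 : ℕ) : ℝ) * ((n - n / 2 : ℕ) : ℝ) * g (n / 2) (n - n / 2) := by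
        gcongr <;> linarith
    _ ≤ M := hM _ (Nat.div_le_self _ _)

set_option maxHeartbeats 1000000 in
/-- Complete bipartite graphs maximize the weighted sum over edges among large graphs without a
large biclique plus an edge. -/
theorem EdgeWeight.exists_sum_le {g : ℕ → ℕ → ℝ} {k : ℕ} {C : ℝ} (hg : EdgeWeight g k C) {t : ℕ}
    (ht : 1 ≤ t) :
    ∃ N : ℕ, ∀ (V : Type*) [Fintype V] [DecidableEq V] (G : SimpleGraph V) [DecidableRel G.Adj],
      N ≤ Fintype.card V → G.BicliquePlusEdgeFree t → ∀ M : ℝ,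
      (∀ m : ℕ, m ≤ Fintype.card V →
        (m : ℝ) * ((Fintype.card V - m : ℕ) : ℝ) * g m (Fintype.card V - m) ≤ M) →
      ∑ u, ∑ w with G.Adj u w, g (G.degree u) (G.degree w) ≤ 2 * M := by
  have hC := hg.pos
  obtain ⟨cM, hcM, N₁, hN₁⟩ := hg.exists_le_bipartite
  -- A sum above 2M forces both A and B to have at least c₁n vertices.
  obtain ⟨c₁, hc₁⟩ : ∃ c₁, c₁ = cM / (2 * C) := ⟨_, rfl⟩
  have hc₁0 : 0 < c₁ := by rw [hc₁]; positivity
  obtain ⟨c₂', hc₂', N₂, hN₂⟩ := hg.lower (c₁ / 2) (by positivity)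
  obtain ⟨c₂, hc₂⟩ : ∃ c₂, c₂ = min c₂' (cM / 3) := ⟨_, rfl⟩
  have hc₂0 : 0 < c₂ := by rw [hc₂]; positivity
  have hc₂a : c₂ ≤ c₂' := hc₂ ▸ min_le_left _ _
  have hc₂b : 3 * c₂ ≤ cM := by
    have : c₂ ≤ cM / 3 := hc₂ ▸ min_le_right _ _
    linarith
  obtain ⟨N₃, hN₃⟩ := hg.neg c₂ hc₂0
  obtain ⟨θ₁, hθ₁⟩ : ∃ θ₁, θ₁ = c₁ / (2 * (t + 3)) := ⟨_, rfl⟩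
  have hθ₁0 : 0 < θ₁ := by rw [hθ₁]; positivity
  -- Edges inside B then offset at most half of the loss c₂·ec.
  obtain ⟨θ₂, hθ₂⟩ : ∃ θ₂, θ₂ = min θ₁ (c₂ * θ₁ / (4 * C * (t + 3))) := ⟨_, rfl⟩
  have hθ₂0 : 0 < θ₂ := by rw [hθ₂]; positivity
  have hθ₂a : θ₂ ≤ θ₁ := hθ₂ ▸ min_le_left _ _
  have hθ₂b : 4 * C * (t + 3) * θ₂ ≤ c₂ * θ₁ := by
    have : θ₂ ≤ c₂ * θ₁ / (4 * C * (t + 3)) := hθ₂ ▸ min_le_right _ _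
    rw [le_div_iff₀ (by positivity)] at this
    linarith
  obtain ⟨γ, hγ⟩ : ∃ γ, γ = c₁ * θ₂ / 2 := ⟨_, rfl⟩
  have hγ0 : 0 < γ := by rw [hγ]; positivity
  -- The three bounds serve, in order, the linear size of A, the other half of the loss (triangles),
  -- and ec ≤ γn².
  obtain ⟨κ, hκ⟩ : ∃ κ, κ = min (cM / C) (min (c₂ * θ₁ / (24 * C)) (c₂ * γ / (3 * C))) :=
    ⟨_, rfl⟩
  have hκ0 : 0 < κ := by rw [hκ]; positivity
  have hκa : κ * C ≤ cM := by
    rw [← le_div_iff₀ hC]; exact hκ ▸ min_le_left _ _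
  have hκb : κ * (24 * C) ≤ c₂ * θ₁ := by
    rw [← le_div_iff₀ (by positivity)]
    exact hκ ▸ (min_le_right _ _).trans (min_le_left _ _)
  have hκc : κ * (3 * C) ≤ c₂ * γ := by
    rw [← le_div_iff₀ (by positivity)]
    exact hκ ▸ (min_le_right _ _).trans (min_le_right _ _)
  obtain ⟨N₄, hN₄⟩ := SimpleGraph.BicliquePlusEdgeFree.exists_link_le ht hκ0
  obtain ⟨N₅, hN₅⟩ := exists_nat_ge (max (2 * t / c₁) (t / θ₂))
  refine ⟨N₁ + N₂ + N₃ + N₄ + N₅ + 1, fun V _ _ G _ hn hG M hM => ?_⟩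
  set n := Fintype.card V with hn_def
  have hn0 : (0 : ℝ) < n := by exact_mod_cast (by omega : 0 < n)
  have hnN₅ : max (2 * t / c₁) (t / θ₂) ≤ (n : ℝ) :=
    hN₅.trans (by exact_mod_cast (by omega : N₅ ≤ n))
  have ht₂ : 2 * t ≤ c₁ * n := by
    have := (le_max_left _ _).trans hnN₅
    rw [div_le_iff₀ hc₁0] at this
    linarith
  have ht₃ : t ≤ θ₂ * n := by
    have := (le_max_right _ _).trans hnN₅
    rw [div_le_iff₀ hθ₂0] at this
    linarith
  have ht₁ : (t + 2) * (θ₁ * n) + t ≤ c₁ * n := by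
    have h1 : θ₁ * (2 * (t + 3)) = c₁ := by rw [hθ₁]; field_simp
    nlinarith [mul_pos hθ₁0 hn0]
  have hMlow := hN₁ n (by omega) M hM
  have hlink := hN₄ V G (by omega) hG
  by_contra! hQ
  obtain ⟨v, -, hv⟩ := exists_max_image (univ : Finset V) (fun u => G.degree u)
    (card_pos.1 (by rw [card_univ]; omega))
  replace hv : ∀ u, G.degree u ≤ G.degree v := fun u => hv u (mem_univ u)
  have hcardN : ∀ u, #{w | G.Adj u w} = G.degree u := fun u => by
    rw [← G.card_neighborFinset_eq_degree, G.neighborFinset_eq_filter]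
  set A : Finset V := {u | ¬ G.Adj v u} with hA
  set B : Finset V := {u | G.Adj v u} with hB
  have hAB : A = Bᶜ := by ext; simp [hA, hB]
  have hnk : (0 : ℝ) < (n : ℝ) ^ k := by positivity
  have hE := hg.sum_le_card_mul (G := G)
  have heB : ∑ u ∈ B, (#{w ∈ B | G.Adj u w} : ℝ) ≤ κ * n ^ 2 := by
    have := hlink v
    simp_rw [← filter_filter] at this
    exact this
  have hBn : c₁ * n ≤ #B := by
    rw [hcardN v]
    have h1 : ∑ u, (#{w | G.Adj u w} : ℝ) ≤ n * G.degree v := by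
      rw [← nsmul_eq_mul, hn_def, ← card_univ]
      exact sum_le_card_nsmul _ _ _ fun u _ => by rw [hcardN]; exact_mod_cast hv u
    have h2 : n ^ k * n * (2 * cM * n) < n ^ k * n * (C * G.degree v) := by
      have : C * (n : ℝ) ^ k * ∑ u, (#{w | G.Adj u w} : ℝ) ≤ C * (n : ℝ) ^ k * (n * G.degree v) := by
        gcongr
      linarith
    have h3 := lt_of_mul_lt_mul_left h2 (by positivity)
    rw [hc₁, div_mul_eq_mul_div, div_le_iff₀ (by positivity)]
    linarith [mul_pos hcM hn0]
  have hAn : c₁ * n ≤ #A := by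
    have h1 := SimpleGraph.sum_card_adj_le_of_split (G := G) A B hAB
    have h2 : n ^ k * n * (2 * cM * n) < n ^ k * n * (C * (2 * #A) + cM * n) := by
      have h3 : C * (n : ℝ) ^ k * ∑ u, (#{w | G.Adj u w} : ℝ) ≤
          C * (n : ℝ) ^ k * (2 * (#A * n) + κ * n ^ 2) := by
        gcongr; linarith
      have h4 : κ * C * ((n : ℝ) ^ k * n ^ 2) ≤ cM * ((n : ℝ) ^ k * n ^ 2) := by gcongr
      linarith
    have h3 := lt_of_mul_lt_mul_left h2 (by positivity)
    rw [hc₁, div_mul_eq_mul_div, div_le_iff₀ (by positivity)]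
    linarith
  have hlow : ∀ x y : ℕ, (G.degree v : ℝ) / 2 ≤ x → (G.degree v : ℝ) / 2 ≤ y →
      c₂ * (n : ℝ) ^ k ≤ g x y := by
    intro x y hx hy
    rw [hcardN v] at hBn
    refine le_trans ?_ (hN₂ n (by omega) x y (by linarith) (by linarith))
    gcongr
  have hmain := hg.sum_add_loss_le G hM hv hc₂0 hlow (hN₃ n (by omega))
    (le_trans (by gcongr) hMlow)
  rw [← hn_def] at hmain
  simp_rw [← filter_filter (fun w => G.Adj v w)] at hmain
  rw [← hA, ← hB] at hmain
  set ec := ∑ u ∈ A, (#{w ∈ B | ¬ G.Adj u w} : ℝ) with hec_def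
  set eB := ∑ u ∈ B, (#{w ∈ B | G.Adj u w} : ℝ) with heB_def
  set T := ∑ u, ∑ w with G.Adj u w, (#{x | G.Adj u x ∧ G.Adj w x} : ℝ) with hT_def
  have hT : T ≤ κ * n ^ 3 := by
    refine (sum_le_card_nsmul _ _ _ fun u _ => hlink u).trans (le_of_eq ?_)
    rw [nsmul_eq_mul, card_univ, ← hn_def]; ring
  have hmain' : n ^ k * (c₂ * ec) < n ^ k * (2 * C * (T / n) + C * eB) := by
    have : 2 * (C * (n : ℝ) ^ k / n) * T = n ^ k * (2 * C * (T / n)) := by ring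
    rw [this] at hmain
    linarith
  replace hmain' := lt_of_mul_lt_mul_left hmain' hnk.le
  -- The crude link bounds on T and eB give near-completeness, which is what the sharper bounds
  -- require.
  have hec : ec ≤ γ * n ^ 2 := by
    have h1 : T / n ≤ κ * n ^ 2 := by
      rw [div_le_iff₀ hn0]; linarith
    have h2 : 2 * C * (T / n) + C * eB ≤ κ * (3 * C) * n ^ 2 := by
      have : 2 * C * (T / n) + C * eB ≤ 2 * C * (κ * n ^ 2) + C * (κ * n ^ 2) := by gcongr
      linarith
    have h3 : κ * (3 * C) * n ^ 2 ≤ c₂ * γ * n ^ 2 := by gcongr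
    have h4 : c₂ * ec ≤ c₂ * (γ * n ^ 2) := by linarith
    exact le_of_mul_le_mul_left h4 hc₂0
  obtain ⟨hT', heB'⟩ := hG.triangles_and_edges_le (v := v) (A := A) (B := B)
    (fun u => by simp only [hA, hB, mem_filter, mem_univ, true_and]; tauto)
    (fun w hw => (mem_filter.1 hw).2) hn0 hθ₁0 hθ₂0 hθ₂a hκ0 hγ.le hc₁0 hAn hBn hec ht₁ ht₂ ht₃
    hlink
  rw [← hec_def] at hT' heB'
  have hec0 : 0 ≤ ec := sum_nonneg fun _ _ => Nat.cast_nonneg _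
  have h1 : θ₁ * (T / n) ≤ 6 * κ * ec := by
    rw [mul_div_assoc', div_le_iff₀ hn0]; linarith
  have h2 : θ₁ * (2 * C * (T / n) + C * eB) ≤ θ₁ * (c₂ * ec) := by
    have h3 : 2 * C * (θ₁ * (T / n)) ≤ 2 * C * (6 * κ * ec) := by gcongr
    have h4 : C * (θ₁ * eB) ≤ C * (2 * (t + 3) * θ₂ * ec) := by gcongr
    have h5 := mul_le_mul_of_nonneg_right hκb hec0
    have h6 := mul_le_mul_of_nonneg_right hθ₂b hec0
    linarith
  exact absurd (le_of_mul_le_mul_left h2 hθ₁0) (not_le.2 hmain')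

/-! ### From the index to row sums, and conclusion -/

/-- The symmetrization `f(x, y) + f(y, x)`. -/
noncomputable def symmPoly (f : MvPolynomial (Fin 2) ℝ) : MvPolynomial (Fin 2) ℝ :=
  f + MvPolynomial.rename (Equiv.swap 0 1) f

theorem polyVal_symmPoly (f : MvPolynomial (Fin 2) ℝ) (x y : ℕ) :
    polyVal (symmPoly f) x y = polyVal f x y + polyVal f y x := by
  have h : (![(x : ℝ), (y : ℝ)] ∘ (Equiv.swap 0 1 : Equiv.Perm (Fin 2))) = ![(y : ℝ), (x : ℝ)] := by
    ext i; fin_cases i <;> simp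
  simp only [polyVal, symmPoly, map_add, MvPolynomial.eval_rename, h]

theorem IsMonotonePoly.symmPoly {f : MvPolynomial (Fin 2) ℝ} (hf : IsMonotonePoly f) :
    IsMonotonePoly (symmPoly f) := fun x x' y y' hx hy hxx hyy => by
  rw [polyVal_symmPoly, polyVal_symmPoly]
  exact add_le_add (hf _ _ _ _ hx hy hxx hyy) (hf _ _ _ _ hy hx hyy hxx)

theorem polyVal_symmPoly_comm (f : MvPolynomial (Fin 2) ℝ) (x y : ℕ) :
    polyVal (symmPoly f) x y = polyVal (symmPoly f) y x := by
  rw [polyVal_symmPoly, polyVal_symmPoly, add_comm]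

theorem SimpleGraph.sum_sum_adj_eq_two_mul_sum_edgeFinset {V : Type*} [Fintype V] [DecidableEq V]
    (G : SimpleGraph V) [DecidableRel G.Adj] (φ : Sym2 V → ℝ) :
    ∑ u, ∑ w with G.Adj u w, φ s(u, w) = 2 * ∑ e ∈ G.edgeFinset, φ e := by
  simp_rw [sum_filter]
  rw [← sum_product', univ_product_univ,
    ← sum_filter (fun p : V × V => G.Adj p.1 p.2) (fun p => φ s(p.1, p.2)),
    ← sum_fiberwise_of_maps_to (t := G.edgeFinset) (g := fun p : V × V => s(p.1, p.2)), mul_sum]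
  · refine sum_congr rfl fun e he => ?_
    induction e with
    | _ a b =>
    have hab : G.Adj a b := by simpa using he
    have hfib : {p ∈ ({p : V × V | G.Adj p.1 p.2} : Finset (V × V)) | s(p.1, p.2) = s(a, b)} =
        {(a, b), (b, a)} := by
      ext ⟨x, y⟩
      simp only [mem_filter, mem_univ, true_and, mem_insert, mem_singleton, Prod.mk.injEq,
        Sym2.eq_iff]
      constructor
      · exact fun h => h.2
      · rintro (⟨rfl, rfl⟩ | ⟨rfl, rfl⟩)
        · exact ⟨hab, .inl ⟨rfl, rfl⟩⟩
        · exact ⟨hab.symm, .inr ⟨rfl, rfl⟩⟩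
    rw [hfib, sum_pair (fun h => hab.ne (Prod.mk.inj h).1), Sym2.eq_swap (a := b)]
    ring
  · rintro ⟨x, y⟩ h
    simpa using h

open Classical in
theorem two_mul_topIndex (f : MvPolynomial (Fin 2) ℝ) {V : Type*} [Fintype V]
    (G : SimpleGraph V) : 2 * topIndex f G =
      ∑ u, ∑ w with G.Adj u w, polyVal (symmPoly f) (G.degree u) (G.degree w) := by
  rw [topIndex, ← G.sum_sum_adj_eq_two_mul_sum_edgeFinset]
  simp_rw [Sym2.lift_mk, polyVal_symmPoly]

theorem topIndex_congr (f : MvPolynomial (Fin 2) ℝ) {V V' : Type*} [Fintype V] [Fintype V']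
    {G : SimpleGraph V} {G' : SimpleGraph V'} (e : G ≃g G') : topIndex f G = topIndex f G' := by
  classical
  refine mul_left_cancel₀ (two_ne_zero (α := ℝ)) ?_
  rw [two_mul_topIndex, two_mul_topIndex]
  refine Fintype.sum_equiv e.toEquiv _ _ fun u => ?_
  simp_rw [sum_filter]
  refine Fintype.sum_equiv e.toEquiv _ _ fun w => ?_
  have hu : G'.degree (e.toEquiv u) = G.degree u := e.degree_eq u
  have hw : G'.degree (e.toEquiv w) = G.degree w := e.degree_eq w
  have hadj : G'.Adj (e.toEquiv u) (e.toEquiv w) ↔ G.Adj u w := e.map_adj_iff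
  simp only [hu, hw, hadj]

theorem topIndex_completeBipartiteGraph (f : MvPolynomial (Fin 2) ℝ) (a b : ℕ) :
    topIndex f (completeBipartiteGraph (Fin a) (Fin b)) =
      (a : ℝ) * (b : ℝ) * polyVal (symmPoly f) a b := by
  classical
  have hl : ∀ i : Fin a, (completeBipartiteGraph (Fin a) (Fin b)).degree (Sum.inl i) = b := by
    intro i
    have h : (completeBipartiteGraph (Fin a) (Fin b)).neighborFinset (Sum.inl i) =
        univ.map Function.Embedding.inr := by
      ext x; cases x <;> simp
    rw [← SimpleGraph.card_neighborFinset_eq_degree, h, card_map, card_univ, Fintype.card_fin]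
  have hr : ∀ j : Fin b, (completeBipartiteGraph (Fin a) (Fin b)).degree (Sum.inr j) = a := by
    intro j
    have h : (completeBipartiteGraph (Fin a) (Fin b)).neighborFinset (Sum.inr j) =
        univ.map Function.Embedding.inl := by
      ext x; cases x <;> simp
    rw [← SimpleGraph.card_neighborFinset_eq_degree, h, card_map, card_univ, Fintype.card_fin]
  refine mul_left_cancel₀ (two_ne_zero (α := ℝ)) ?_
  rw [two_mul_topIndex]
  simp_rw [sum_filter, Fintype.sum_sum_type, hl, hr]
  simp [polyVal_symmPoly_comm f b a]
  ring

theorem SimpleGraph.free_completeBipartiteGraph {W : Type*} {F : SimpleGraph W}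
    (hχ : F.chromaticNumber = 3) (X Y : Type*) : F.Free (completeBipartiteGraph X Y) := by
  rintro ⟨c⟩
  have h2 : F.Colorable 2 := by
    simpa using SimpleGraph.Coloring.colorable
      ((CompleteBipartiteGraph.bicoloring X Y).comp c.toHom)
  have := h2.chromaticNumber_le
  rw [hχ] at this
  exact absurd this (by decide)

open Classical in
/-- For large `n`, no `F`-free graph has a larger index than all complete bipartite graphs. -/
theorem IsMonotonePoly.exists_topIndex_le {f : MvPolynomial (Fin 2) ℝ} (hf : IsMonotonePoly f)
    {W : Type*} [Fintype W] {F : SimpleGraph W} (hχ : F.chromaticNumber = 3)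
    (hcrit : HasColorCriticalEdge F) :
    ∃ N : ℕ, ∀ n : ℕ, N ≤ n → ∀ G : SimpleGraph (Fin n), F.Free G → ∀ M : ℝ,
      (∀ m ≤ n, topIndex f (completeBipartiteGraph (Fin m) (Fin (n - m))) ≤ M) →
      topIndex f G ≤ M := by
  simp_rw [topIndex_completeBipartiteGraph]
  rcases hf.symmPoly.nonpos_or_edgeWeight (polyVal_symmPoly_comm f) with hneg | ⟨k, C, hg⟩
  · refine ⟨0, fun n _ G _ M hM => ?_⟩
    -- The edgeless case m = 0 has index 0.
    have hM0 : 0 ≤ M := by simpa using hM 0 (Nat.zero_le _)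
    have hQ : 2 * topIndex f G ≤ 0 := by
      rw [two_mul_topIndex]
      refine sum_nonpos fun u _ => sum_nonpos fun w hw => ?_
      have huw : G.Adj u w := (mem_filter.1 hw).2
      exact hneg _ _ ((G.degree_pos_iff_exists_adj u).2 ⟨w, huw⟩)
        ((G.degree_pos_iff_exists_adj w).2 ⟨u, huw.symm⟩)
    linarith
  · have ht : 1 ≤ Fintype.card W := by
      obtain ⟨e, -, -⟩ := hcrit
      induction e with
      | _ a b => exact Fintype.card_pos_iff.2 ⟨a⟩
    obtain ⟨N, hN⟩ := hg.exists_sum_le ht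
    refine ⟨N, fun n hn G hG M hM => ?_⟩
    have := hN (Fin n) G (by simpa using hn) (hG.bicliquePlusEdgeFree hχ hcrit) M
      (by simpa using hM)
    rw [← two_mul_topIndex] at this
    linarith

theorem mainTheorem6 (f : MvPolynomial (Fin 2) ℝ) (hf : IsMonotonePoly f)
    {W : Type*} [Fintype W] (F : SimpleGraph W) (hχ : F.chromaticNumber = 3)
    (hcrit : HasColorCriticalEdge F) :
    ∃ N : ℕ, ∀ n : ℕ, N ≤ n → ∃ m : ℕ, m ≤ n ∧
      exIndex f n F = topIndex f (completeBipartiteGraph (Fin m) (Fin (n - m))) := by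
  obtain ⟨N, hN⟩ := hf.exists_topIndex_le hχ hcrit
  refine ⟨N, fun n hn => ?_⟩
  obtain ⟨m, hm, hmax⟩ := exists_max_image (range (n + 1))
    (fun m => topIndex f (completeBipartiteGraph (Fin m) (Fin (n - m)))) ⟨0, by simp⟩
  have hmn : m ≤ n := Nat.lt_succ_iff.1 (mem_range.1 hm)
  have hF : F ≠ ⊥ := by
    rintro rfl
    obtain ⟨e, he, -⟩ := hcrit
    simp at he
  have hgr := isGreatest_exIndex f n F hF
  refine ⟨m, hmn, le_antisymm ?_ (hgr.2 ?_)⟩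
  · obtain ⟨G, hG, hGe⟩ := hgr.1
    rw [← hGe]
    exact hN n hn G hG _ fun m' hm' => hmax m' (mem_range.2 (Nat.lt_succ_iff.2 hm'))
  · have hc : Fintype.card (Fin m ⊕ Fin (n - m)) = n := by
      simp only [Fintype.card_sum, Fintype.card_fin]; omega
    -- Moves the bipartite graph to the vertex set `Fin n`, where `exIndex` is defined.
    let e := (completeBipartiteGraph (Fin m) (Fin (n - m))).overFinIso hc
    exact ⟨_, (SimpleGraph.free_congr_right e).1 (SimpleGraph.free_completeBipartiteGraph hχ _ _),
      (topIndex_congr f e).symm⟩
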